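/- Let $a,b,c\in\mathbb R$ satisfy ($c=0$ and $a\ne b$) or ($c>0$ and $a<b$). Put $Q(x)=ax(x-1)+bx+c$, let $\nu_0$ be the largest real root of $Q$ (with $\max\{0,\nu_0\}:=0$ if $Q$ has no real root), and let $\nu\ge\max\{0,\nu_0\}$ with $Q(\nu)\neq 0$. Let $J_\nu$ be the Bessel function of the first kind, $N_\nu(z)=az^2J_\nu''(z)+bzJ_\nu'(z)+cJ_\nu(z)$, and $$f_\nu(z)=\Big[\tfrac{2^\nu\Gamma(\nu+1)}{Q(\nu)}N_\nu(z)\Big]^{1/\nu}\ (\nu\ne0),\qquad g_\nu(z)=\tfrac{2^\nu\Gamma(\nu+1)}{Q(\nu)}z^{1-\nu}N_\nu(z),\qquad h_\nu(z)=\tfrac{2^\nu\Gamma(\nu+1)}{Q(\nu)}z^{1-\nu/2}N_\nu(\sqrt z),$$ on the analytic branches vanishing at $0$ with derivative $1$ there. Let $\varphi$ be analytic and univalent on the unit disk $\mathbb D$ with $\operatorname{Re}\varphi>0$, $\varphi'(0)>0$, and $\varphi(\mathbb D)$ starlike with respect to $\varphi(0)=1$ and symmetric about the real axis. Let $\beta$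 be the radius of the largest disk $\{w:|w-1|<\beta\}\subseteq\varphi(\mathbb D)$, and suppose that $\varphi(-1)=1-\beta$, where $\varphi(-1)=\lim_{x\to-1^+}\varphi(x)$. For a function $f$ analytic near $0$ with $f(0)=0$, $f'(0)=1$, its $\mathcal C(\varphi)$-radius is $$\sup\Big\{r>0:\ 1+\frac{zf''(z)}{f'(z)}\in\varphi(\mathbb D)\ \text{ for all } |z|<r\Big\}.$$ Let $\lambda_{\nu,1}$ be the smallest positive zero of $N_\nu$ (it exists). Then: (a) if $\nu\neq0$, the $\mathcal C(\varphi)$-radius of $f_\nu$ is the smallest positive root of $rf_\nu''(r)+\beta f_\nu'(r)=0$, and it lies in $(0,\lambda_{\nu,1})$; (b) the $\mathcal C(\varphi)$-radius of $g_\nu$ is the smallest positive root of $rg_\nu''(r)+\beta g_\nu'(r)=0$, and it lies in $(0,\lambda_{\nu,1})$; (c) the $\mathcal C(\varphi)$-radius of $h_\nu$ is the smallest positive root of $rh_\nu''(r)+\beta h_\nu'(r)=0$, and it lies in $(0,\lambda_{\nu,1}^2)$. -/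

import Mathlib

open Set Filter Topology Metric

noncomputable section

namespace MaMindaBessel

/-- The Bessel function of the first kind
`J_ν(z) = ∑ (-1)ⁿ / (n! Γ(n+ν+1)) (z/2)^(2n+ν)` (principal branch of the power). -/
def besselJ (ν : ℝ) (z : ℂ) : ℂ :=
  ∑' n : ℕ, (((-1) ^ n / (n.factorial * Real.Gamma (n + ν + 1)) : ℝ) : ℂ) *
    (z / 2) ^ (2 * (n : ℂ) + (ν : ℂ))

/-- `N_ν(z) = a z² J_ν''(z) + b z J_ν'(z) + c J_ν(z)`. -/
def besselN (a b c ν : ℝ) (z : ℂ) : ℂ :=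
  a * z ^ 2 * deriv (deriv (besselJ ν)) z + b * z * deriv (besselJ ν) z + c * besselJ ν z

/-- The quadratic `Q(x) = a x (x - 1) + b x + c`. -/
def Q (a b c x : ℝ) : ℝ := a * x * (x - 1) + b * x + c

/-- The entire function `E` for which
`2^ν Γ(ν+1) / Q(ν) * N_ν(z) = z^ν * E(z²)` on the slit plane; see `besselN_eq`. -/
def E (a b c ν : ℝ) (w : ℂ) : ℂ :=
  ∑' n : ℕ, (((-1) ^ n * Q a b c (2 * n + ν) * Real.Gamma (ν + 1) /
    (Q a b c ν * (n.factorial * Real.Gamma (n + ν + 1))) : ℝ) : ℂ) * (w / 4) ^ n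

/-- The analytic branch of `log E(z²)` that vanishes at `z = 0`: the integral of the logarithmic
derivative of `ζ ↦ E(ζ²)` along the segment from `0` to `z`; see `exp_logE`. -/
def logE (a b c ν : ℝ) (z : ℂ) : ℂ :=
  ∫ t in (0 : ℝ)..1, z * logDeriv (fun ζ : ℂ => E a b c ν (ζ ^ 2)) (t * z)

/-- `f_ν(z) = [2^ν Γ(ν+1) / Q(ν) * N_ν(z)]^(1/ν)`, on the branch that is analytic near `0` with
`f_ν(0) = 0`, `f_ν'(0) = 1`; see `fFun_eq`. -/
def fFun (a b c ν : ℝ) (z : ℂ) : ℂ := z * Complex.exp (logE a b c ν z / ν)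

/-- `g_ν(z) = 2^ν Γ(ν+1) z^(1-ν) / Q(ν) * N_ν(z)`, as an entire function; see `gFun_eq`. -/
def gFun (a b c ν : ℝ) (z : ℂ) : ℂ := z * E a b c ν (z ^ 2)

/-- `h_ν(z) = 2^ν Γ(ν+1) z^(1-ν/2) / Q(ν) * N_ν(√z)`, as an entire function; see `hFun_eq`. -/
def hFun (a b c ν : ℝ) (z : ℂ) : ℂ := z * E a b c ν z

/-- A Ma-Minda function on the unit disk. -/
structure IsMaMinda (φ : ℂ → ℂ) : Prop where
  differentiableOn : DifferentiableOn ℂ φ (ball 0 1)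
  injOn : InjOn φ (ball 0 1)
  re_pos : ∀ z ∈ ball (0 : ℂ) 1, 0 < (φ z).re
  map_zero : φ 0 = 1
  deriv_re_pos : 0 < (deriv φ 0).re
  deriv_im : (deriv φ 0).im = 0
  starConvex : StarConvex ℝ 1 (φ '' ball 0 1)
  symm : ∀ w ∈ φ '' ball 0 1, (starRingEnd ℂ) w ∈ φ '' ball 0 1

/-- The radii `r > 0` such that `1 + z f''(z) / f'(z)` is defined and lies in `φ(𝔻)` for all
`|z| < r`. -/
def convexRadii (φ f : ℂ → ℂ) : Set ℝ :=
  {r | 0 < r ∧ ∀ z ∈ ball (0 : ℂ) r,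
    deriv f z ≠ 0 ∧ 1 + z * deriv (deriv f) z / deriv f z ∈ φ '' ball 0 1}

/-- `R` is the `𝒞(φ)`-radius of `f`: the (finite) supremum of `convexRadii φ f`. -/
def IsConvexRadius (φ f : ℂ → ℂ) (R : ℝ) : Prop :=
  (convexRadii φ f).Nonempty ∧ IsLUB (convexRadii φ f) R

/-! The formulas for `N_ν`, `f_ν`, `g_ν`, `h_ν`. -/

/-- The coefficients of `(z/2)^(-ν) J_ν(z)`. -/
def coeff (ν : ℝ) (n : ℕ) : ℝ := (-1) ^ n / (n.factorial * Real.Gamma (n + ν + 1))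

theorem gamma_le {ν : ℝ} (hν : 0 ≤ ν) (n : ℕ) :
    Real.Gamma (ν + 1) ≤ Real.Gamma (n + ν + 1) := by
  induction n with
  | zero => simp
  | succ n ih =>
    have h : ((n + 1 : ℕ) : ℝ) + ν + 1 = (n + ν + 1) + 1 := by push_cast; ring
    have hp : 0 < (n : ℝ) + ν + 1 := by positivity
    rw [h, Real.Gamma_add_one hp.ne']
    have := Real.Gamma_pos_of_pos hp
    nlinarith [Nat.cast_nonneg (α := ℝ) n]

theorem abs_coeff_le {ν : ℝ} (hν : 0 ≤ ν) (n : ℕ) :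
    |coeff ν n| ≤ (Real.Gamma (ν + 1))⁻¹ / n.factorial := by
  have h0 : 0 < Real.Gamma (ν + 1) := Real.Gamma_pos_of_pos (by positivity)
  have h1 := gamma_le hν n
  have h2 : 0 < Real.Gamma (n + ν + 1) := h0.trans_le h1
  have h3 : (0 : ℝ) < n.factorial := by positivity
  rw [coeff, abs_div, abs_pow, abs_neg, abs_one, one_pow, abs_of_pos (by positivity),
    one_div, mul_inv, div_eq_inv_mul]
  gcongr

/-- The summands of `(z/2)^(-ν) J_ν(z)`. -/
def term (ν : ℝ) (n : ℕ) (z : ℂ) : ℂ := (coeff ν n : ℂ) * (z / 2) ^ (2 * n)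

/-- Their derivatives. -/
def term1 (ν : ℝ) (n : ℕ) (z : ℂ) : ℂ := (coeff ν n : ℂ) * (n * (z / 2) ^ (2 * n - 1))

theorem hasDerivAt_term (ν : ℝ) (n : ℕ) (z : ℂ) : HasDerivAt (term ν n) (term1 ν n z) z := by
  have h := ((((hasDerivAt_id z).div_const 2).pow (2 * n)).const_mul (coeff ν n : ℂ))
  refine h.congr_deriv ?_
  simp only [term1, id]
  push_cast
  ring

theorem hasDerivAt_term1 (ν : ℝ) (n : ℕ) (z : ℂ) :
    HasDerivAt (term1 ν n)
      ((coeff ν n : ℂ) * (n * ((2 * n - 1 : ℕ) * (z / 2) ^ (2 * n - 1 - 1) * (1 / 2)))) z := by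
  have h := (((((hasDerivAt_id z).div_const 2).pow (2 * n - 1)).const_mul (n : ℂ)).const_mul
    (coeff ν n : ℂ))
  exact h.congr_deriv (by simp only [id])

theorem summable_bound (K R : ℝ) :
    Summable (fun n : ℕ => K / n.factorial * (2 ^ n * R ^ (2 * n))) := by
  refine ((Real.summable_pow_div_factorial (2 * R ^ 2)).mul_left K).congr fun n => ?_
  rw [mul_pow, ← pow_mul]
  ring

theorem norm_term_le {ν : ℝ} (hν : 0 ≤ ν) {R : ℝ} (n : ℕ) {z : ℂ} (hz : ‖z / 2‖ ≤ R) :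
    ‖term ν n z‖ ≤ (Real.Gamma (ν + 1))⁻¹ / n.factorial * (2 ^ n * R ^ (2 * n)) := by
  have h0 : 0 < Real.Gamma (ν + 1) := Real.Gamma_pos_of_pos (by positivity)
  rw [term, norm_mul, norm_pow, Complex.norm_real, Real.norm_eq_abs]
  have h1 : ‖z / 2‖ ^ (2 * n) ≤ R ^ (2 * n) := by gcongr
  have h2 : (1 : ℝ) ≤ 2 ^ n := one_le_pow₀ (by norm_num)
  have h3 : 0 ≤ R ^ (2 * n) := by rw [pow_mul]; positivity
  have h4 : 0 ≤ (Real.Gamma (ν + 1))⁻¹ / n.factorial := by positivity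
  refine mul_le_mul (abs_coeff_le hν n) ?_ (by positivity) h4
  nlinarith

theorem norm_term1_le {ν : ℝ} (hν : 0 ≤ ν) {R : ℝ} (hR : 1 ≤ R) (n : ℕ) {z : ℂ}
    (hz : ‖z / 2‖ ≤ R) :
    ‖term1 ν n z‖ ≤ (Real.Gamma (ν + 1))⁻¹ / n.factorial * (2 ^ n * R ^ (2 * n)) := by
  have h0 : 0 < Real.Gamma (ν + 1) := Real.Gamma_pos_of_pos (by positivity)
  rw [term1, norm_mul, norm_mul, norm_pow, Complex.norm_real, Real.norm_eq_abs,
    Complex.norm_natCast]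
  have h1 : ‖z / 2‖ ^ (2 * n - 1) ≤ R ^ (2 * n) :=
    (pow_le_pow_left₀ (norm_nonneg _) hz _).trans (pow_le_pow_right₀ hR (Nat.sub_le _ _))
  have h2 : (n : ℝ) ≤ 2 ^ n := by exact_mod_cast n.lt_two_pow_self.le
  have h3 : 0 ≤ R ^ (2 * n) := by positivity
  have h4 : 0 ≤ (Real.Gamma (ν + 1))⁻¹ / n.factorial := by positivity
  exact mul_le_mul (abs_coeff_le hν n)
    (mul_le_mul h2 h1 (by positivity) (by positivity)) (by positivity) h4

/-- `(z/2)^(-ν) J_ν(z)`. -/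
def base (ν : ℝ) (z : ℂ) : ℂ := ∑' n, term ν n z

theorem ball_bound (z : ℂ) : ∃ R : ℝ, 1 ≤ R ∧ z ∈ ball (0 : ℂ) (2 * R) ∧
    ∀ w ∈ ball (0 : ℂ) (2 * R), ‖w / 2‖ ≤ R := by
  refine ⟨‖z‖ + 1, by linarith [norm_nonneg z], ?_, fun w hw => ?_⟩
  · rw [mem_ball_zero_iff]; linarith [norm_nonneg z]
  · rw [mem_ball_zero_iff] at hw
    rw [norm_div, Complex.norm_ofNat]
    linarith

theorem hasSum_base {ν : ℝ} (hν : 0 ≤ ν) (z : ℂ) :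
    HasSum (fun n => term ν n z) (base ν z) := by
  obtain ⟨R, -, hz, hR⟩ := ball_bound z
  exact (Summable.of_norm_bounded (summable_bound _ R)
    fun n => norm_term_le hν n (hR z hz)).hasSum

theorem hasSum_base1 {ν : ℝ} (hν : 0 ≤ ν) (z : ℂ) :
    HasSum (fun n => term1 ν n z) (deriv (base ν) z) := by
  obtain ⟨R, -, hz, hR⟩ := ball_bound z
  have := Complex.hasSum_deriv_of_summable_norm (F := term ν) (summable_bound _ R)
    (fun n w _ => (hasDerivAt_term ν n w).differentiableAt.differentiableWithinAt) isOpen_ball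
    (fun n w hw => norm_term_le hν n (hR w hw)) hz
  exact this.congr_fun fun n => (hasDerivAt_term ν n z).deriv.symm

theorem differentiable_base {ν : ℝ} (hν : 0 ≤ ν) : Differentiable ℂ (base ν) := fun z => by
  obtain ⟨R, -, hz, hR⟩ := ball_bound z
  exact (Complex.differentiableOn_tsum_of_summable_norm (F := term ν) (summable_bound _ R)
    (fun n w _ => (hasDerivAt_term ν n w).differentiableAt.differentiableWithinAt) isOpen_ball
    (fun n w hw => norm_term_le hν n (hR w hw))).differentiableAt (isOpen_ball.mem_nhds hz)

theorem deriv_base {ν : ℝ} (hν : 0 ≤ ν) : deriv (base ν) = fun z => ∑' n, term1 ν n z :=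
  funext fun z => (hasSum_base1 hν z).tsum_eq.symm

theorem hasSum_base2 {ν : ℝ} (hν : 0 ≤ ν) (z : ℂ) :
    HasSum (fun n : ℕ => (coeff ν n : ℂ) *
      (n * ((2 * n - 1 : ℕ) * (z / 2) ^ (2 * n - 1 - 1) * (1 / 2)))) (deriv (deriv (base ν)) z) := by
  obtain ⟨R, h1, hz, hR⟩ := ball_bound z
  have := Complex.hasSum_deriv_of_summable_norm (F := term1 ν) (summable_bound _ R)
    (fun n w _ => (hasDerivAt_term1 ν n w).differentiableAt.differentiableWithinAt) isOpen_ball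
    (fun n w hw => norm_term1_le hν h1 n (hR w hw)) hz
  rw [deriv_base hν]
  exact this.congr_fun fun n => (hasDerivAt_term1 ν n z).deriv.symm

theorem hasSum_E {a b c ν : ℝ} (hν : 0 ≤ ν) (hQ : Q a b c ν ≠ 0) (z : ℂ) :
    HasSum (fun n : ℕ => (((-1) ^ n * Q a b c (2 * n + ν) * Real.Gamma (ν + 1) /
      (Q a b c ν * (n.factorial * Real.Gamma (n + ν + 1))) : ℝ) : ℂ) * (z ^ 2 / 4) ^ n)
    ((Real.Gamma (ν + 1) / Q a b c ν : ℂ) *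
      (a * (ν * (ν - 1) * base ν z + 2 * ν * z * deriv (base ν) z +
        z ^ 2 * deriv (deriv (base ν)) z) +
        b * (ν * base ν z + z * deriv (base ν) z) + c * base ν z)) := by
  have h0 := hasSum_base hν z
  have h1 := hasSum_base1 hν z
  have h2 := hasSum_base2 hν z
  refine (((((h0.mul_left ((ν : ℂ) * (ν - 1))).add (h1.mul_left (2 * ν * z))).add
    (h2.mul_left (z ^ 2))).mul_left (a : ℂ)).add (((h0.mul_left (ν : ℂ)).add
    (h1.mul_left z)).mul_left (b : ℂ)) |>.add (h0.mul_left (c : ℂ))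
    |>.mul_left (Real.Gamma (ν + 1) / Q a b c ν : ℂ)).congr_fun fun n => ?_
  have hQ' : (Q a b c ν : ℂ) ≠ 0 := by exact_mod_cast hQ
  have e1 : z * ((n : ℂ) * (z / 2) ^ (2 * n - 1)) = 2 * n * (z / 2) ^ (2 * n) := by
    rcases n with _ | n
    · simp
    · rw [show 2 * (n + 1) - 1 = 2 * n + 1 by omega, show 2 * (n + 1) = 2 * n + 1 + 1 by ring]
      ring
  have e2 : z ^ 2 * ((n : ℂ) * ((2 * n - 1 : ℕ) * (z / 2) ^ (2 * n - 1 - 1) * (1 / 2))) =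
      2 * n * (2 * n - 1) * (z / 2) ^ (2 * n) := by
    rcases n with _ | n
    · simp
    · rw [show 2 * (n + 1) - 1 = 2 * n + 1 by omega, show 2 * (n + 1) = 2 * n + 1 + 1 by ring]
      push_cast
      ring
  have e3 : (z ^ 2 / 4) ^ n = (z / 2) ^ (2 * n) := by
    rw [pow_mul]; congr 1; ring
  have e4 : (((-1) ^ n * Q a b c (2 * n + ν) * Real.Gamma (ν + 1) /
      (Q a b c ν * (n.factorial * Real.Gamma (n + ν + 1))) : ℝ) : ℂ) =
      Real.Gamma (ν + 1) / Q a b c ν * ((coeff ν n : ℂ) * Q a b c (2 * n + ν)) := by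
    rw [coeff]; push_cast; ring
  have e5 : (Q a b c (2 * n + ν) : ℂ) =
      a * (2 * n + ν) * (2 * n + ν - 1) + b * (2 * n + ν) + c := by
    simp only [Q]; push_cast; ring
  rw [e4, e3, e5]
  simp only [term, term1]
  linear_combination (-(Real.Gamma (ν + 1) / Q a b c ν : ℂ) * coeff ν n) *
    ((a * 2 * ν + b) * e1 + a * e2)

theorem E_sq {a b c ν : ℝ} (hν : 0 ≤ ν) (hQ : Q a b c ν ≠ 0) (z : ℂ) :
    E a b c ν (z ^ 2) = (Real.Gamma (ν + 1) / Q a b c ν : ℂ) *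
      (a * (ν * (ν - 1) * base ν z + 2 * ν * z * deriv (base ν) z +
        z ^ 2 * deriv (deriv (base ν)) z) +
        b * (ν * base ν z + z * deriv (base ν) z) + c * base ν z) :=
  (hasSum_E hν hQ z).tsum_eq

theorem half_mem_slitPlane {z : ℂ} (hz : z ∈ Complex.slitPlane) : z / 2 ∈ Complex.slitPlane := by
  rw [Complex.mem_slitPlane_iff] at *
  have h1 : (z / 2).re = z.re / 2 := by simp
  have h2 : (z / 2).im = z.im / 2 := by simp
  rw [h1, h2]
  rcases hz with h | h
  · exact Or.inl (by positivity)
  · exact Or.inr (by positivity)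

theorem besselJ_eq {ν : ℝ} {z : ℂ} (hz : z ∈ Complex.slitPlane) :
    besselJ ν z = (z / 2) ^ (ν : ℂ) * base ν z := by
  have h0 : z / 2 ≠ 0 := Complex.slitPlane_ne_zero (half_mem_slitPlane hz)
  rw [besselJ, base, ← tsum_mul_left]
  refine tsum_congr fun n => ?_
  rw [Complex.cpow_add _ _ h0, term, coeff]
  have : (z / 2) ^ (2 * (n : ℂ)) = (z / 2) ^ (2 * n) := by
    rw [← Complex.cpow_natCast]; push_cast; rfl
  rw [this]; ring

theorem hasDerivAt_pow {ν : ℝ} {z : ℂ} (hz : z ∈ Complex.slitPlane) :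
    HasDerivAt (fun w : ℂ => (w / 2) ^ (ν : ℂ)) (ν / z * (z / 2) ^ (ν : ℂ)) z := by
  have h0 : z / 2 ≠ 0 := Complex.slitPlane_ne_zero (half_mem_slitPlane hz)
  have hz0 : z ≠ 0 := Complex.slitPlane_ne_zero hz
  refine (((hasDerivAt_id z).div_const 2).cpow_const (c := (ν : ℂ))
    (half_mem_slitPlane hz)).congr_deriv ?_
  simp only [id]
  rw [Complex.cpow_sub _ _ h0, Complex.cpow_one]
  field_simp

/-- Power-series form of `N_ν` on the slit plane. -/
theorem besselN_eq {a b c ν : ℝ} (hν : 0 ≤ ν) (hQ : Q a b c ν ≠ 0) {z : ℂ}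
    (hz : z ∈ Complex.slitPlane) :
    ((2 ^ ν * Real.Gamma (ν + 1) / Q a b c ν : ℝ) : ℂ) * besselN a b c ν z =
      z ^ (ν : ℂ) * E a b c ν (z ^ 2) := by
  have hS := Complex.isOpen_slitPlane
  have hB := differentiable_base hν
  have hB' : Differentiable ℂ (deriv (base ν)) := fun w =>
    ((hB.analyticAt w).deriv).differentiableAt
  have d1 : ∀ w ∈ Complex.slitPlane, deriv (besselJ ν) w =
      (w / 2) ^ (ν : ℂ) * (ν / w * base ν w + deriv (base ν) w) := fun w hw => by
    have he : besselJ ν =ᶠ[𝓝 w] fun w => (w / 2) ^ (ν : ℂ) * base ν w :=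
      eventually_of_mem (hS.mem_nhds hw) fun u hu => besselJ_eq hu
    rw [he.deriv_eq]
    refine (((hasDerivAt_pow hw).mul (hB w).hasDerivAt).congr_deriv ?_).deriv
    ring
  have hz0 : z ≠ 0 := Complex.slitPlane_ne_zero hz
  have d2 : deriv (deriv (besselJ ν)) z = (z / 2) ^ (ν : ℂ) *
      (ν * (ν - 1) / z ^ 2 * base ν z + 2 * ν / z * deriv (base ν) z +
        deriv (deriv (base ν)) z) := by
    have he : deriv (besselJ ν) =ᶠ[𝓝 z] fun w =>
        (w / 2) ^ (ν : ℂ) * (ν / w * base ν w + deriv (base ν) w) :=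
      eventually_of_mem (hS.mem_nhds hz) fun u hu => d1 u hu
    have hd : HasDerivAt (fun w : ℂ => (ν : ℂ) / w) (-ν / z ^ 2) z := by
      simpa [div_eq_mul_inv] using (hasDerivAt_inv hz0).const_mul (ν : ℂ)
    rw [he.deriv_eq]
    refine (((hasDerivAt_pow hz).mul ((hd.mul (hB z).hasDerivAt).add
      (hB' z).hasDerivAt)).congr_deriv ?_).deriv
    simp only [Pi.add_apply, Pi.mul_apply]
    field_simp
    ring
  have hp : z ^ (ν : ℂ) = ((2 ^ ν : ℝ) : ℂ) * (z / 2) ^ (ν : ℂ) := by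
    rw [Complex.ofReal_cpow (by norm_num : (0 : ℝ) ≤ 2)]
    have h2 : (z / 2) = ((2⁻¹ : ℝ) : ℂ) * z := by push_cast; ring
    have h3 : z = ((2 : ℝ) : ℂ) * (z / 2) := by push_cast; ring
    have hh : z / 2 ≠ 0 := Complex.slitPlane_ne_zero (half_mem_slitPlane hz)
    have h2' : ((2 : ℝ) : ℂ) ≠ 0 := by norm_num
    rw [Complex.cpow_def_of_ne_zero hz0, Complex.cpow_def_of_ne_zero hh,
      Complex.cpow_def_of_ne_zero h2', ← Complex.exp_add]
    conv_lhs => rw [h3, Complex.log_ofReal_mul (by norm_num) hh, Complex.ofReal_log (by norm_num)]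
    ring_nf
  rw [besselN, d2, d1 z hz, besselJ_eq hz, E_sq hν hQ, hp]
  have hQ' : (Q a b c ν : ℂ) ≠ 0 := by exact_mod_cast hQ
  push_cast
  field_simp

theorem gFun_eq {a b c ν : ℝ} (hν : 0 ≤ ν) (hQ : Q a b c ν ≠ 0) {z : ℂ}
    (hz : z ∈ Complex.slitPlane) :
    gFun a b c ν z = ((2 ^ ν * Real.Gamma (ν + 1) / Q a b c ν : ℝ) : ℂ) *
      z ^ (1 - ν : ℂ) * besselN a b c ν z := by
  have hz0 : z ≠ 0 := Complex.slitPlane_ne_zero hz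
  have hp : z ^ (ν : ℂ) ≠ 0 := by simp [Complex.cpow_eq_zero_iff, hz0]
  rw [mul_right_comm, besselN_eq hν hQ hz, Complex.cpow_sub _ _ hz0, Complex.cpow_one, gFun]
  field_simp

theorem hFun_eq {a b c ν : ℝ} (hν : 0 ≤ ν) (hQ : Q a b c ν ≠ 0) {z : ℂ}
    (hz : z ∈ Complex.slitPlane) :
    hFun a b c ν z = ((2 ^ ν * Real.Gamma (ν + 1) / Q a b c ν : ℝ) : ℂ) *
      z ^ (1 - ν / 2 : ℂ) * besselN a b c ν (z ^ (1 / 2 : ℂ)) := by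
  have hz0 : z ≠ 0 := Complex.slitPlane_ne_zero hz
  have hπ := Real.pi_pos
  have h1 : z.arg < Real.pi :=
    lt_of_le_of_ne (Complex.arg_le_pi z) (Complex.slitPlane_arg_ne_pi hz)
  have h2 : -Real.pi < z.arg := Complex.neg_pi_lt_arg z
  have him : (Complex.log z * (1 / 2)).im = z.arg / 2 := by
    simp [Complex.mul_im, Complex.log_im, div_eq_mul_inv]
  have hsq : (z ^ (1 / 2 : ℂ)) ^ 2 = z := by
    simp
  have hmem : z ^ (1 / 2 : ℂ) ∈ Complex.slitPlane := by
    refine Or.inl ?_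
    rw [Complex.cpow_def_of_ne_zero hz0, Complex.exp_re, him]
    exact mul_pos (Real.exp_pos _) (Real.cos_pos_of_mem_Ioo ⟨by linarith, by linarith⟩)
  have hpow : (z ^ (1 / 2 : ℂ)) ^ (ν : ℂ) = z ^ (ν / 2 : ℂ) := by
    rw [← Complex.cpow_mul _ (by rw [him]; linarith) (by rw [him]; linarith)]
    congr 1; ring
  have hp : z ^ (ν / 2 : ℂ) ≠ 0 := by simp [Complex.cpow_eq_zero_iff, hz0]
  rw [mul_right_comm, besselN_eq hν hQ hmem, hsq, hpow, Complex.cpow_sub _ _ hz0,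
    Complex.cpow_one, hFun]
  field_simp

theorem differentiable_E {a b c ν : ℝ} (hν : 0 ≤ ν) (hQ : Q a b c ν ≠ 0) :
    Differentiable ℂ (fun z : ℂ => E a b c ν (z ^ 2)) := by
  have hB := differentiable_base hν
  have hB' : Differentiable ℂ (deriv (base ν)) := fun w =>
    ((hB.analyticAt w).deriv).differentiableAt
  have hB'' : Differentiable ℂ (deriv (deriv (base ν))) := fun w =>
    ((hB'.analyticAt w).deriv).differentiableAt
  rw [funext (E_sq (a := a) (b := b) (c := c) hν hQ)]
  fun_prop

theorem E_zero {a b c ν : ℝ} (hν : 0 ≤ ν) (hQ : Q a b c ν ≠ 0) : E a b c ν 0 = 1 := by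
  have h0 : Real.Gamma (ν + 1) ≠ 0 := (Real.Gamma_pos_of_pos (by positivity)).ne'
  rw [E, tsum_eq_single 0 fun n hn => by simp [hn]]
  simp
  exact ⟨hQ, h0⟩

/-- `logE` is an analytic logarithm of `E(z²)` on every disk without zeros of `E(z²)`. -/
theorem exp_logE {a b c ν : ℝ} (hν : 0 ≤ ν) (hQ : Q a b c ν ≠ 0) {ρ : ℝ}
    (h : ∀ z ∈ ball (0 : ℂ) ρ, E a b c ν (z ^ 2) ≠ 0) :
    DifferentiableOn ℂ (logE a b c ν) (ball 0 ρ) ∧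
      ∀ z ∈ ball (0 : ℂ) ρ, Complex.exp (logE a b c ν z) = E a b c ν (z ^ 2) := by
  set u : ℂ → ℂ := fun z => E a b c ν (z ^ 2) with hu
  have hd : Differentiable ℂ u := differentiable_E hν hQ
  have hd' : Differentiable ℂ (deriv u) := fun w =>
    ((hd.analyticAt w).deriv).differentiableAt
  have hl : DifferentiableOn ℂ (logDeriv u) (ball 0 ρ) :=
    hd'.differentiableOn.div hd.differentiableOn h
  obtain ⟨L, hL⟩ := hl.isExactOn_ball.with_val_at 0 0
  have hL0 : L 0 = 0 := hL.1
  have hL1 : ∀ z ∈ ball (0 : ℂ) ρ, HasDerivAt L (logDeriv u z) z := hL.2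
  have hseg : ∀ z ∈ ball (0 : ℂ) ρ, ∀ t ∈ uIcc (0 : ℝ) 1, (t : ℂ) * z ∈ ball (0 : ℂ) ρ := by
    intro z hz t ht
    rw [uIcc_of_le zero_le_one] at ht
    rw [mem_ball_zero_iff] at *
    rw [norm_mul, Complex.norm_real, Real.norm_eq_abs, abs_of_nonneg ht.1]
    nlinarith [ht.2, norm_nonneg z]
  have heq : ∀ z ∈ ball (0 : ℂ) ρ, logE a b c ν z = L z := by
    intro z hz
    have hder : ∀ t ∈ uIcc (0 : ℝ) 1,
        HasDerivAt (fun t : ℝ => L (t * z)) (z * logDeriv u (t * z)) t := by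
      intro t ht
      have h1 : HasDerivAt (fun s : ℂ => s * z) z (t : ℂ) := by
        simpa using (hasDerivAt_id (t : ℂ)).mul_const z
      have h2 := (HasDerivAt.comp (t : ℂ) (hL1 _ (hseg z hz t ht)) h1).comp_ofReal
      exact h2.congr_deriv (mul_comm _ _)
    have hc : ContinuousOn (fun t : ℝ => z * logDeriv u (t * z)) (uIcc 0 1) :=
      continuousOn_const.mul (hl.continuousOn.comp (by fun_prop) (hseg z hz))
    have := intervalIntegral.integral_eq_sub_of_hasDerivAt hder hc.intervalIntegrable
    rw [logE, this]
    simp [hL0]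
  refine ⟨fun z hz => ((hL1 z hz).differentiableAt.differentiableWithinAt).congr heq (heq z hz),
    fun z hz => ?_⟩
  rw [heq z hz]
  have hz0 : (0 : ℂ) ∈ ball (0 : ℂ) ρ := mem_ball_self (pos_of_mem_ball hz)
  have key : ∀ w ∈ ball (0 : ℂ) ρ, HasDerivAt (fun w => u w * Complex.exp (-L w)) 0 w := by
    intro w hw
    refine ((hd w).hasDerivAt.mul (hL1 w hw).neg.cexp).congr_deriv ?_
    have hw0 : u w ≠ 0 := h w hw
    rw [logDeriv_apply, Pi.neg_apply]
    field_simp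
    ring
  have hconst := isOpen_ball.is_const_of_deriv_eq_zero (convex_ball (0 : ℂ) ρ).isPreconnected
    (fun w hw => (key w hw).differentiableAt.differentiableWithinAt)
    (fun w hw => (key w hw).deriv) hz hz0
  have hu0 : u 0 = 1 := by simp [hu, E_zero hν hQ]
  simp only [hL0, hu0, neg_zero, Complex.exp_zero, mul_one] at hconst
  rw [Complex.exp_neg] at hconst
  field_simp at hconst
  exact hconst.symm

/-- On every disk without zeros of `E(z²)`, `fFun` is analytic, normalized, and a branch of
`[2^ν Γ(ν+1) / Q(ν) * N_ν(z)]^(1/ν)`. -/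
theorem fFun_eq {a b c ν : ℝ} (hν : 0 < ν) (hQ : Q a b c ν ≠ 0) {ρ : ℝ} (hρ : 0 < ρ)
    (h : ∀ z ∈ ball (0 : ℂ) ρ, E a b c ν (z ^ 2) ≠ 0) :
    DifferentiableOn ℂ (fFun a b c ν) (ball 0 ρ) ∧ fFun a b c ν 0 = 0 ∧
      deriv (fFun a b c ν) 0 = 1 ∧
      ∀ z ∈ ball (0 : ℂ) ρ, z ∈ Complex.slitPlane →
        ∃ w : ℂ, Complex.exp w = fFun a b c ν z ∧ Complex.exp (ν * w) =
          ((2 ^ ν * Real.Gamma (ν + 1) / Q a b c ν : ℝ) : ℂ) * besselN a b c ν z := by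
  obtain ⟨h1, h2⟩ := exp_logE hν.le hQ h
  have hν' : (ν : ℂ) ≠ 0 := by exact_mod_cast hν.ne'
  have hd : DifferentiableOn ℂ (fun z => Complex.exp (logE a b c ν z / ν)) (ball 0 ρ) :=
    (h1.div_const _).cexp
  refine ⟨differentiableOn_id.mul hd, by simp [fFun], ?_, fun z hz hs => ?_⟩
  · have h3 := (hasDerivAt_id (0 : ℂ)).mul
      (hd.differentiableAt (isOpen_ball.mem_nhds (mem_ball_self hρ))).hasDerivAt
    refine (h3.congr_deriv ?_).deriv
    simp [logE]
  · have hz0 : z ≠ 0 := Complex.slitPlane_ne_zero hs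
    refine ⟨Complex.log z + logE a b c ν z / ν, ?_, ?_⟩
    · rw [Complex.exp_add, Complex.exp_log hz0, fFun]
    · rw [besselN_eq hν.le hQ hs, ← h2 z hz, Complex.cpow_def_of_ne_zero hz0, ← Complex.exp_add]
      congr 1
      field_simp

end MaMindaBessel

/-!
Let `E(w)`, with `w = z²`, be the entire function obtained from `N_ν` by normalization. All three
claims rest on the fact that `-E'/E` has nonnegative Taylor coefficients at `0`, which is shown
without the Hadamard product of `E`. For the normalized Bessel function the coefficients of `-E'/E`
obey a Riccati recursion and are even bounded below by a geometric sequence. Passing from `J_ν` to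
`N_ν` multiplies the `n`-th coefficient by `Q(2n + ν) / Q(ν)`. Because of Bessel's equation this is
an operator `F ↦ F + p w F' - t w F` with `p, t ≥ 0`, or two such operators with `t = 0`, one for
each root of `Q`; these operators preserve the lower bound.

The geometric lower bound forces `E` to have a zero, and nonnegativity puts a zero of smallest
modulus on the positive axis. On the corresponding disk each of `f = f_ν, g_ν, h_ν` satisfies
`z f' / f = 1 - S`, where `S` has nonnegative coefficients and takes the value `1` at a point of
the positive axis, so `|z f''/f'| ≤ s + x s' / (1 - s)` for `x = |z|` and `s = S(x) < 1`, with
equality at `z = x`. Hence `1 + z f''/f'` first leaves `φ(𝔻)` at `1 - β`, on the positive axis.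
-/

section PowerSeriesOnDisk

open PowerSeries

/-- `f` is the sum of the formal power series `F` on the disk `|z| < R`. -/
def HasPowerSeriesOnDisk (f : ℂ → ℂ) (F : ℂ⟦X⟧) (R : ℝ) : Prop :=
  ∀ z ∈ ball (0 : ℂ) R, HasSum (fun n => coeff n F * z ^ n) (f z)

/-- The Taylor series of `f` at `0`, as a formal power series. -/
def taylorPowerSeries (f : ℂ → ℂ) : ℂ⟦X⟧ :=
  mk fun n => (n.factorial : ℂ)⁻¹ * iteratedDeriv n f 0

theorem derivative_taylorPowerSeries (f : ℂ → ℂ) :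
    d⁄dX ℂ (taylorPowerSeries f) = taylorPowerSeries (deriv f) := by
  ext n
  rw [coeff_derivative, taylorPowerSeries, taylorPowerSeries, coeff_mk, coeff_mk,
    iteratedDeriv_succ', Nat.factorial_succ]
  push_cast
  have hn : (n : ℂ) + 1 ≠ 0 := n.cast_add_one_ne_zero
  field_simp

variable {f g : ℂ → ℂ} {F G : ℂ⟦X⟧} {R : ℝ}

theorem hasPowerSeriesOnDisk_taylorPowerSeries (hf : DifferentiableOn ℂ f (ball 0 R)) :
    HasPowerSeriesOnDisk f (taylorPowerSeries f) R := fun z hz => by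
  refine (Complex.hasSum_taylorSeries_on_ball hf hz).congr_fun fun n => ?_
  rw [taylorPowerSeries, coeff_mk, sub_zero, smul_eq_mul, smul_eq_mul]
  ring

namespace HasPowerSeriesOnDisk

theorem congr (h : HasPowerSeriesOnDisk f F R) (hfg : EqOn f g (ball 0 R)) :
    HasPowerSeriesOnDisk g F R := fun z hz => hfg hz ▸ h z hz

theorem hasFPowerSeriesOnBall (h : HasPowerSeriesOnDisk f F R) (hR : 0 < R) :
    HasFPowerSeriesOnBall f (FormalMultilinearSeries.ofScalars ℂ fun n => coeff n F) 0
      (ENNReal.ofReal R) where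
  r_le := by
    refine ENNReal.le_of_forall_nnreal_lt fun r hr => ?_
    refine FormalMultilinearSeries.le_radius_of_summable _ ?_
    have hr' : ((r : ℝ) : ℂ) ∈ ball (0 : ℂ) R := by
      have := (ENNReal.lt_ofReal_iff_toReal_lt ENNReal.coe_ne_top).1 hr
      simpa using this
    simpa [FormalMultilinearSeries.ofScalars_norm] using (h r hr').summable.norm
  r_pos := ENNReal.ofReal_pos.2 hR
  hasSum := fun {z} hz => by
    rw [eball_ofReal] at hz
    simpa [FormalMultilinearSeries.ofScalars_apply_eq, mul_comm] using h z hz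

theorem differentiableOn (h : HasPowerSeriesOnDisk f F R) :
    DifferentiableOn ℂ f (ball 0 R) := by
  rcases le_or_gt R 0 with hR | hR
  · simp only [ball_eq_empty.2 hR, differentiableOn_empty]
  · simpa only [eball_ofReal] using (h.hasFPowerSeriesOnBall hR).differentiableOn

theorem unique (hF : HasPowerSeriesOnDisk f F R) (hG : HasPowerSeriesOnDisk f G R)
    (hR : 0 < R) : F = G := by
  have heq := (hF.hasFPowerSeriesOnBall hR).hasFPowerSeriesAt.eq_formalMultilinearSeries
    (hG.hasFPowerSeriesOnBall hR).hasFPowerSeriesAt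
  ext n
  simpa [FormalMultilinearSeries.coeff_ofScalars] using congrArg (fun p => p.coeff n) heq

protected theorem deriv (h : HasPowerSeriesOnDisk f F R) :
    HasPowerSeriesOnDisk (deriv f) (d⁄dX ℂ F) R := fun z hz => by
  have hf := h.differentiableOn
  rw [h.unique (hasPowerSeriesOnDisk_taylorPowerSeries hf) (pos_of_mem_ball hz),
    derivative_taylorPowerSeries]
  exact hasPowerSeriesOnDisk_taylorPowerSeries (hf.deriv isOpen_ball) z hz

protected theorem neg (h : HasPowerSeriesOnDisk f F R) :
    HasPowerSeriesOnDisk (fun z => -f z) (-F) R := fun z hz => by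
  simpa only [map_neg, neg_mul] using (h z hz).neg

protected theorem const_mul (h : HasPowerSeriesOnDisk f F R) (c : ℂ) :
    HasPowerSeriesOnDisk (fun z => c * f z) (C c * F) R := fun z hz => by
  simpa only [coeff_C_mul, mul_assoc] using (h z hz).mul_left c

protected theorem mul (hf : HasPowerSeriesOnDisk f F R) (hg : HasPowerSeriesOnDisk g G R) :
    HasPowerSeriesOnDisk (fun z => f z * g z) (F * G) R := fun z hz => by
  have hnf := (hf z hz).summable.norm
  have hng := (hg z hz).summable.norm
  have hfg := tsum_mul_tsum_eq_tsum_sum_antidiagonal_of_summable_norm hnf hng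
  rw [(hf z hz).tsum_eq, (hg z hz).tsum_eq] at hfg
  simp only [hfg]
  refine (summable_norm_sum_mul_antidiagonal_of_summable_norm hnf hng).of_norm.hasSum.congr_fun
    fun n => ?_
  rw [coeff_mul, Finset.sum_mul]
  refine Finset.sum_congr rfl fun p hp => ?_
  rw [← Finset.HasAntidiagonal.mem_antidiagonal.1 hp, pow_add]
  ring

theorem id_mul (h : HasPowerSeriesOnDisk f F R) :
    HasPowerSeriesOnDisk (fun z => z * f z) (X * F) R := by
  refine HasPowerSeriesOnDisk.mul (fun z _ => ?_) h
  have hsum := hasSum_single (f := fun n => coeff n (X : ℂ⟦X⟧) * z ^ n) 1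
    fun n hn => by rw [coeff_X, if_neg hn, zero_mul]
  simpa only [coeff_one_X, one_mul, pow_one] using hsum

theorem comp_pow {p : ℕ} (hp : p ≠ 0) (h : HasPowerSeriesOnDisk f F (R ^ p)) :
    HasPowerSeriesOnDisk (fun z => f (z ^ p)) (expand p hp F) R := fun z hz => by
  have hzp : z ^ p ∈ ball (0 : ℂ) (R ^ p) := by
    rw [mem_ball_zero_iff] at hz ⊢
    rw [norm_pow]
    gcongr
  refine ((mul_right_injective₀ hp).hasSum_iff fun n hn => ?_).1 ((h _ hzp).congr_fun fun n => ?_)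
  · have hdvd : ¬ p ∣ n := fun ⟨k, hk⟩ => hn ⟨k, hk.symm⟩
    rw [coeff_expand_of_not_dvd p hp F hdvd, zero_mul]
  · rw [Function.comp_apply, coeff_expand_mul, pow_mul]

theorem neg_logDeriv {S : ℂ⟦X⟧} (h : HasPowerSeriesOnDisk f F R) (hFS : d⁄dX ℂ F = -(S * F))
    (hne : ∀ z ∈ ball (0 : ℂ) R, f z ≠ 0) :
    HasPowerSeriesOnDisk (fun z => -logDeriv f z) S R := fun z hz => by
  have hR := pos_of_mem_ball hz
  have hdiff : DifferentiableOn ℂ (fun z => -logDeriv f z) (ball 0 R) :=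
    ((h.deriv.differentiableOn).div h.differentiableOn hne).neg
  have hT := hasPowerSeriesOnDisk_taylorPowerSeries hdiff
  have hTF : taylorPowerSeries (fun z => -logDeriv f z) * F = S * F := by
    refine neg_injective ?_
    rw [← hFS]
    refine (((hT.mul h).neg).congr fun w hw => ?_).unique h.deriv hR
    simp only [logDeriv_apply, neg_mul, neg_neg]
    exact div_mul_cancel₀ _ (hne w hw)
  have hF : F ≠ 0 := by
    rintro rfl
    refine hne 0 (mem_ball_self hR) ((h 0 (mem_ball_self hR)).unique ?_)
    simp [hasSum_zero]
  exact mul_right_cancel₀ hF hTF ▸ hT z hz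

end HasPowerSeriesOnDisk

end PowerSeriesOnDisk

section NonnegCoefficients

open PowerSeries

theorem map_ofReal_derivative (F : ℝ⟦X⟧) :
    (d⁄dX ℝ F).map Complex.ofRealHom = d⁄dX ℂ (F.map Complex.ofRealHom) := by
  ext n
  simp [coeff_derivative]

namespace HasPowerSeriesOnDisk

variable {f g : ℂ → ℂ} {F G : ℝ⟦X⟧} {R x y : ℝ}

theorem hasSum_ofReal (h : HasPowerSeriesOnDisk f (F.map Complex.ofRealHom) R)
    (hx : (x : ℂ) ∈ ball 0 R) :
    HasSum (fun n => ((coeff n F * x ^ n : ℝ) : ℂ)) (f x) := by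
  simpa using h x hx

theorem hasSum_re (h : HasPowerSeriesOnDisk f (F.map Complex.ofRealHom) R)
    (hx : (x : ℂ) ∈ ball 0 R) : HasSum (fun n => coeff n F * x ^ n) (f x).re := by
  simpa only [Complex.ofReal_re] using Complex.hasSum_re (h.hasSum_ofReal hx)

theorem ofReal_re (h : HasPowerSeriesOnDisk f (F.map Complex.ofRealHom) R)
    (hx : (x : ℂ) ∈ ball 0 R) : ((f x).re : ℂ) = f x :=
  (Complex.hasSum_ofReal.2 (h.hasSum_re hx)).unique (h.hasSum_ofReal hx)

theorem norm_le_re_norm (h : HasPowerSeriesOnDisk f (F.map Complex.ofRealHom) R)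
    (hF : ∀ n, 0 ≤ coeff n F) {z : ℂ} (hz : z ∈ ball 0 R) : ‖f z‖ ≤ (f ‖z‖).re := by
  have hsum := h.hasSum_re (x := ‖z‖) (by simpa using hz)
  rw [← (h z hz).tsum_eq]
  refine tsum_of_norm_bounded hsum fun n => ?_
  simp [abs_of_nonneg (hF n)]

theorem re_le_re (h : HasPowerSeriesOnDisk f (F.map Complex.ofRealHom) R)
    (hF : ∀ n, 0 ≤ coeff n F) (hx : 0 ≤ x) (hxy : x ≤ y) (hy : y < R) : (f x).re ≤ (f y).re :=
  hasSum_le (fun n => mul_le_mul_of_nonneg_left (pow_le_pow_left₀ hx hxy n) (hF n))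
    (h.hasSum_re (by simpa [abs_of_nonneg hx] using hxy.trans_lt hy))
    (h.hasSum_re (by simpa [abs_of_nonneg (hx.trans hxy)] using hy))

theorem re_le_re_of_coeff_le (hf : HasPowerSeriesOnDisk f (F.map Complex.ofRealHom) R)
    (hg : HasPowerSeriesOnDisk g (G.map Complex.ofRealHom) R)
    (hFG : ∀ n, coeff n F ≤ coeff n G) (hx : 0 ≤ x) (hxR : x < R) : (f x).re ≤ (g x).re :=
  have hmem : (x : ℂ) ∈ ball 0 R := by simpa [abs_of_nonneg hx] using hxR
  hasSum_le (fun n => mul_le_mul_of_nonneg_right (hFG n) (pow_nonneg hx n))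
    (hf.hasSum_re hmem) (hg.hasSum_re hmem)

end HasPowerSeriesOnDisk

end NonnegCoefficients

section LogarithmicDerivative

open PowerSeries

/-- The formal logarithmic derivative `-F'/F` of `F` has coefficients growing at least like a
geometric sequence, so that it is nonnegative and not the Taylor series of an entire function. -/
def HasGeometricLogDeriv (F : ℝ⟦X⟧) : Prop :=
  ∃ (S : ℝ⟦X⟧) (v : ℝ), d⁄dX ℝ F = -(S * F) ∧ 0 < v ∧ ∀ n, v ^ (n + 1) ≤ coeff n S

theorem coeff_X_mul_derivative (F : ℝ⟦X⟧) (n : ℕ) :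
    coeff n (X * d⁄dX ℝ F) = n * coeff n F := by
  cases n with
  | zero => rw [coeff_zero_X_mul, Nat.cast_zero, zero_mul]
  | succ n =>
    rw [coeff_succ_X_mul, coeff_derivative]
    push_cast
    ring

theorem coeff_mul_nonneg {F G : ℝ⟦X⟧} (hF : ∀ n, 0 ≤ coeff n F) (hG : ∀ n, 0 ≤ coeff n G)
    (n : ℕ) : 0 ≤ coeff n (F * G) := by
  rw [coeff_mul]
  exact Finset.sum_nonneg fun p _ => mul_nonneg (hF _) (hG _)

theorem coeff_inv_one_sub_X_mul_nonneg {U : ℝ⟦X⟧} (hU : ∀ n, 0 ≤ coeff n U) (n : ℕ) :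
    0 ≤ coeff n (1 - X * U)⁻¹ := by
  have hinv : (1 - X * U) * (1 - X * U)⁻¹ = 1 := PowerSeries.mul_inv_cancel _ (by simp)
  have hgeom : (1 - X * U)⁻¹ = 1 + X * (U * (1 - X * U)⁻¹) := by linear_combination hinv
  induction n using Nat.strong_induction_on with
  | _ n ih =>
    rw [hgeom, map_add, coeff_one]
    cases n with
    | zero => simp
    | succ n =>
      rw [if_neg n.succ_ne_zero, zero_add, coeff_succ_X_mul, coeff_mul]
      refine Finset.sum_nonneg fun p hp => mul_nonneg (hU _) (ih _ ?_)
      have := Finset.HasAntidiagonal.mem_antidiagonal.1 hp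
      omega

-- With `U = p S + t`, the new series is `(1 - X U) F`, whose logarithmic derivative is
-- `S + (X U)' / (1 - X U)`.
theorem HasGeometricLogDeriv.add_X_mul_derivative_sub_X_mul {F : ℝ⟦X⟧}
    (h : HasGeometricLogDeriv F) {p t : ℝ} (hp : 0 ≤ p) (ht : 0 ≤ t) :
    HasGeometricLogDeriv (F + C p * (X * d⁄dX ℝ F) - C t * (X * F)) := by
  obtain ⟨S, v, hFS, hv, hS⟩ := h
  set U := C p * S + C t with hU
  have hU_nonneg : ∀ n, 0 ≤ coeff n U := fun n => by
    rw [hU, map_add, coeff_C_mul, coeff_C]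
    have hSn : 0 ≤ coeff n S := (pow_nonneg hv.le _).trans (hS n)
    split_ifs <;> positivity
  have hXU_nonneg : ∀ n, 0 ≤ coeff n (d⁄dX ℝ (X * U)) := fun n => by
    rw [coeff_derivative, coeff_succ_X_mul]
    exact mul_nonneg (hU_nonneg n) (by positivity)
  have hinv : (1 - X * U) * (1 - X * U)⁻¹ = 1 := PowerSeries.mul_inv_cancel _ (by simp)
  have hfactor : F + C p * (X * d⁄dX ℝ F) - C t * (X * F) = (1 - X * U) * F := by
    rw [hFS, hU]
    ring
  refine ⟨S + d⁄dX ℝ (X * U) * (1 - X * U)⁻¹, v, ?_, hv, fun n => ?_⟩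
  · rw [hfactor, Derivation.leibniz, hFS, map_sub, derivative_one]
    simp only [smul_eq_mul]
    linear_combination (d⁄dX ℝ (X * U) * F) * hinv
  · rw [map_add]
    linarith [hS n, coeff_mul_nonneg hXU_nonneg (coeff_inv_one_sub_X_mul_nonneg hU_nonneg) n]

theorem HasGeometricLogDeriv.add_X_mul_derivative {F : ℝ⟦X⟧}
    (h : HasGeometricLogDeriv F) {p : ℝ} (hp : 0 ≤ p) :
    HasGeometricLogDeriv (F + C p * (X * d⁄dX ℝ F)) := by
  simpa only [map_zero, zero_mul, sub_zero] using h.add_X_mul_derivative_sub_X_mul hp le_rfl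

/-- The power series of the normalized Bessel function `Γ(ν+1) (√w/2)^(-ν) J_ν(√w)` in `w`. -/
def besselSeries (ν : ℝ) : ℝ⟦X⟧ :=
  mk fun n => (-1) ^ n * Real.Gamma (ν + 1) / (n.factorial * Real.Gamma (n + ν + 1)) / 4 ^ n

variable {ν : ℝ}

theorem coeff_zero_besselSeries (hν : -1 < ν) : coeff 0 (besselSeries ν) = 1 := by
  have hΓ : Real.Gamma (ν + 1) ≠ 0 := (Real.Gamma_pos_of_pos (by linarith)).ne'
  simp [besselSeries, hΓ]

theorem coeff_succ_besselSeries (hν : -1 < ν) (n : ℕ) :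
    4 * (n + 1) * (n + 1 + ν) * coeff (n + 1) (besselSeries ν) = -coeff n (besselSeries ν) := by
  have hp : 0 < (n : ℝ) + ν + 1 := by linarith [n.cast_nonneg (α := ℝ)]
  have hshift : ((n + 1 : ℕ) : ℝ) + ν + 1 = (n + ν + 1) + 1 := by push_cast; ring
  have hΓ := (Real.Gamma_pos_of_pos hp).ne'
  rw [besselSeries, coeff_mk, coeff_mk, hshift, Real.Gamma_add_one hp.ne', Nat.factorial_succ]
  push_cast
  field_simp
  ring

theorem coeff_X_mul_besselSeries (hν : -1 < ν) (n : ℕ) :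
    coeff n (X * besselSeries ν) = -(4 * n * (n + ν) * coeff n (besselSeries ν)) := by
  cases n with
  | zero => simp
  | succ n =>
    rw [coeff_succ_X_mul]
    push_cast
    linarith [coeff_succ_besselSeries hν n]

theorem besselSeries_ode (hν : -1 < ν) :
    X * d⁄dX ℝ (d⁄dX ℝ (besselSeries ν)) + C (ν + 1) * d⁄dX ℝ (besselSeries ν) +
      C (1 / 4) * besselSeries ν = 0 := by
  ext n
  simp only [map_add (coeff n), coeff_X_mul_derivative, coeff_C_mul, coeff_derivative, map_zero]
  linarith [coeff_succ_besselSeries hν n]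

theorem riccati_of_besselSeries {S : ℝ⟦X⟧} (hν : -1 < ν)
    (hS : d⁄dX ℝ (besselSeries ν) = -(S * besselSeries ν)) :
    X * d⁄dX ℝ S + C (ν + 1) * S = X * (S * S) + C (1 / 4) := by
  have hJ : besselSeries ν ≠ 0 := fun h => by simpa [h] using coeff_zero_besselSeries hν
  have hode := besselSeries_ode hν
  rw [hS, map_neg, Derivation.leibniz, hS, smul_eq_mul, smul_eq_mul] at hode
  refine mul_right_cancel₀ hJ ?_
  linear_combination -hode

-- The convolution sum has `n + 1` terms, each at least `K² v ^ (n + 2)`, and `n + K ≤ (n + 1) K`.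
theorem geometric_le_of_convolution_le {σ : ℕ → ℝ} {K v : ℝ} (hK : 1 ≤ K) (hv : 0 ≤ v)
    (h₀ : K * v ≤ σ 0)
    (hσ : ∀ n, ∑ p ∈ Finset.HasAntidiagonal.antidiagonal n, σ p.1 * σ p.2 ≤ (n + K) * σ (n + 1))
    (n : ℕ) : K * v ^ (n + 1) ≤ σ n := by
  induction n using Nat.strong_induction_on with
  | _ n ih =>
    cases n with
    | zero => simpa only [zero_add, pow_one] using h₀
    | succ n =>
      have hterm : ∀ p ∈ Finset.HasAntidiagonal.antidiagonal n,
          K ^ 2 * v ^ (n + 2) ≤ σ p.1 * σ p.2 := fun p hp => by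
        have hpn := Finset.HasAntidiagonal.mem_antidiagonal.1 hp
        calc K ^ 2 * v ^ (n + 2) = (K * v ^ (p.1 + 1)) * (K * v ^ (p.2 + 1)) := by
              rw [← hpn]
              ring
          _ ≤ σ p.1 * σ p.2 := mul_le_mul (ih _ (by omega)) (ih _ (by omega)) (by positivity)
              ((by positivity : 0 ≤ K * v ^ (p.1 + 1)).trans (ih _ (by omega)))
      have hsum := (Finset.card_nsmul_le_sum _ _ _ hterm).trans (hσ n)
      rw [Finset.Nat.card_antidiagonal, nsmul_eq_mul] at hsum
      refine le_of_mul_le_mul_left (hsum.trans' ?_) (by positivity)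
      calc (n + K) * (K * v ^ (n + 1 + 1)) ≤ ((n + 1) * K) * (K * v ^ (n + 1 + 1)) := by
            gcongr
            nlinarith [n.cast_nonneg (α := ℝ)]
        _ = ((n + 1 : ℕ) : ℝ) * (K ^ 2 * v ^ (n + 2)) := by
            push_cast
            ring

theorem le_coeff_of_riccati {S : ℝ⟦X⟧} (hν : -1 < ν)
    (hS : X * d⁄dX ℝ S + C (ν + 1) * S = X * (S * S) + C (1 / 4)) (n : ℕ) :
    (ν + 2) * (1 / (4 * (ν + 1) * (ν + 2))) ^ (n + 1) ≤ coeff n S := by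
  have hν₁ : 0 < ν + 1 := by linarith
  have hν₂ : 0 < ν + 2 := by linarith
  have hcoeff := fun n => congrArg (coeff n) hS
  simp only [map_add (coeff _), coeff_X_mul_derivative, coeff_C_mul, coeff_C] at hcoeff
  refine geometric_le_of_convolution_le (σ := fun n => coeff n S) (by linarith) (by positivity)
    ?_ (fun n => ?_) n
  · have hzero := hcoeff 0
    rw [coeff_zero_X_mul, if_pos rfl, Nat.cast_zero, zero_mul, zero_add, zero_add] at hzero
    rw [eq_div_of_mul_eq hν₁.ne' ((mul_comm _ _).trans hzero)]
    exact le_of_eq (by field_simp)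
  · have hsucc := hcoeff (n + 1)
    rw [coeff_succ_X_mul, if_neg n.succ_ne_zero, add_zero, coeff_mul] at hsucc
    push_cast at hsucc
    linarith

theorem hasGeometricLogDeriv_besselSeries (hν : -1 < ν) :
    HasGeometricLogDeriv (besselSeries ν) := by
  have hν1 : 0 < ν + 1 := by linarith
  have hν2 : 1 ≤ ν + 2 := by linarith
  have hinv : besselSeries ν * (besselSeries ν)⁻¹ = 1 := PowerSeries.mul_inv_cancel _ (by
    rw [← coeff_zero_eq_constantCoeff_apply, coeff_zero_besselSeries hν]
    exact one_ne_zero)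
  have hS : d⁄dX ℝ (besselSeries ν) =
      -(-(d⁄dX ℝ (besselSeries ν) * (besselSeries ν)⁻¹) * besselSeries ν) := by
    linear_combination -d⁄dX ℝ (besselSeries ν) * hinv
  refine ⟨_, 1 / (4 * (ν + 1) * (ν + 2)), hS, by positivity, fun n => ?_⟩
  exact (le_mul_of_one_le_left (by positivity) hν2).trans
    (le_coeff_of_riccati hν (riccati_of_besselSeries hν hS) n)

end LogarithmicDerivative

section FirstZero

open PowerSeries

variable {E : ℂ → ℂ} {F : ℝ⟦X⟧}

theorem differentiable_of_hasPowerSeriesOnDisk {G : ℂ⟦X⟧}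
    (h : ∀ R, HasPowerSeriesOnDisk E G R) : Differentiable ℂ E := fun z =>
  (h (‖z‖ + 1)).differentiableOn.differentiableAt (isOpen_ball.mem_nhds (by simp))

theorem neg_logDeriv_of_ofReal {S : ℝ⟦X⟧} {R : ℝ}
    (hE : HasPowerSeriesOnDisk E (F.map Complex.ofRealHom) R) (hFS : d⁄dX ℝ F = -(S * F))
    (hne : ∀ z ∈ ball (0 : ℂ) R, E z ≠ 0) :
    HasPowerSeriesOnDisk (fun z => -logDeriv E z) (S.map Complex.ofRealHom) R := by
  refine hE.neg_logDeriv ?_ hne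
  rw [← map_ofReal_derivative, hFS, map_neg, map_mul]

-- Otherwise `-E'/E` would be entire, while its Taylor series diverges at `v⁻¹`.
theorem exists_zero_of_hasGeometricLogDeriv (hF : HasGeometricLogDeriv F)
    (hE : ∀ R, HasPowerSeriesOnDisk E (F.map Complex.ofRealHom) R) : ∃ z, E z = 0 := by
  obtain ⟨S, v, hFS, hv, hS⟩ := hF
  by_contra! hne
  have hseries := neg_logDeriv_of_ofReal (hE (v⁻¹ + 1)) hFS fun z _ => hne z
  have hmem : ((v⁻¹ : ℝ) : ℂ) ∈ ball (0 : ℂ) (v⁻¹ + 1) := by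
    simp [abs_of_pos hv]
  have hlim := (hseries.hasSum_re hmem).summable.tendsto_atTop_zero
  have hterm : ∀ n, v ≤ coeff n S * v⁻¹ ^ n := fun n => calc
    v = v ^ (n + 1) * v⁻¹ ^ n := by rw [pow_succ, inv_pow]; field_simp
    _ ≤ coeff n S * v⁻¹ ^ n := by gcongr; exact hS n
  exact hv.not_ge (ge_of_tendsto' hlim hterm)

theorem exists_zero_of_minimal_norm {E : ℂ → ℂ} (hE : Continuous E) (hzero : ∃ z, E z = 0) :
    ∃ w, E w = 0 ∧ ∀ z ∈ ball (0 : ℂ) ‖w‖, E z ≠ 0 := by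
  obtain ⟨w, hw, hmin⟩ :=
    (isClosed_eq hE continuous_const).exists_infDist_eq_dist (s := {z | E z = 0}) (x := 0) hzero
  refine ⟨w, hw, fun z hz hEz => ?_⟩
  have hle := infDist_le_dist_of_mem (x := 0) (show z ∈ {z | E z = 0} from hEz)
  rw [hmin, dist_zero_left, dist_zero_left] at hle
  exact (mem_ball_zero_iff.1 hz).not_ge hle

theorem mul_exp_eq_one_of_logDeriv {E L : ℂ → ℂ} {R : ℝ} (hE : DifferentiableOn ℂ E (ball 0 R))
    (hE₀ : E 0 = 1) (hne : ∀ z ∈ ball (0 : ℂ) R, E z ≠ 0) (hL₀ : L 0 = 0)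
    (hL : ∀ z ∈ ball 0 R, HasDerivAt L (-logDeriv E z) z) {z : ℂ} (hz : z ∈ ball 0 R) :
    E z * Complex.exp (L z) = 1 := by
  have hderiv : ∀ w ∈ ball (0 : ℂ) R, HasDerivAt (fun w => E w * Complex.exp (L w)) 0 w :=
    fun w hw => by
      have hEw := (hE.differentiableAt (isOpen_ball.mem_nhds hw)).hasDerivAt
      refine (hEw.mul (hL w hw).cexp).congr_deriv ?_
      rw [logDeriv_apply]
      have := hne w hw
      field_simp
      ring
  have hconst := isOpen_ball.is_const_of_deriv_eq_zero (convex_ball (0 : ℂ) R).isPreconnected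
    (fun w hw => (hderiv w hw).differentiableAt.differentiableWithinAt)
    (fun w hw => (hderiv w hw).deriv) hz (mem_ball_self (pos_of_mem_ball hz))
  simpa [hE₀, hL₀] using hconst

theorem exists_primitive_of_hasPowerSeriesOnDisk {f : ℂ → ℂ} {S : ℝ⟦X⟧} {R : ℝ} (hR : 0 < R)
    (hf : HasPowerSeriesOnDisk f (S.map Complex.ofRealHom) R) :
    ∃ L : ℂ → ℂ, L 0 = 0 ∧ (∀ z ∈ ball 0 R, HasDerivAt L (f z) z) ∧
      HasPowerSeriesOnDisk L ((mk fun n => coeff (n - 1) S / n).map Complex.ofRealHom) R := by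
  obtain ⟨L, hL₀, hL⟩ := hf.differentiableOn.isExactOn_ball.with_val_at 0 0
  have hd : DifferentiableOn ℂ L (ball 0 R) := fun z hz =>
    (hL z hz).differentiableAt.differentiableWithinAt
  have hT := hasPowerSeriesOnDisk_taylorPowerSeries hd
  refine ⟨L, hL₀, hL, ?_⟩
  convert hT using 1
  refine derivative.ext ?_ ?_
  · rw [(hT.deriv.congr fun z hz => (hL z hz).deriv).unique hf hR, ← map_ofReal_derivative]
    congr 1
    ext n
    rw [coeff_derivative, coeff_mk, Nat.add_sub_cancel, Nat.cast_succ,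
      div_mul_cancel₀ _ n.cast_add_one_ne_zero]
  · simp only [← coeff_zero_eq_constantCoeff_apply, coeff_map, taylorPowerSeries, coeff_mk]
    simp [hL₀]

-- Write `E = exp (-L)`, where `L` has nonnegative coefficients.
theorem norm_apply_norm_le_norm {S : ℝ⟦X⟧} {R : ℝ} (hE : DifferentiableOn ℂ E (ball 0 R))
    (hE₀ : E 0 = 1) (hne : ∀ z ∈ ball (0 : ℂ) R, E z ≠ 0)
    (hS : HasPowerSeriesOnDisk (fun z => -logDeriv E z) (S.map Complex.ofRealHom) R)
    (hS_nonneg : ∀ n, 0 ≤ coeff n S) {z : ℂ} (hz : z ∈ ball 0 R) : ‖E ‖z‖‖ ≤ ‖E z‖ := by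
  obtain ⟨L, hL₀, hL, hLS⟩ := exists_primitive_of_hasPowerSeriesOnDisk (pos_of_mem_ball hz) hS
  have hnorm : ∀ w ∈ ball (0 : ℂ) R, ‖E w‖ = Real.exp (-(L w).re) := fun w hw => by
    rw [eq_inv_of_mul_eq_one_left (mul_exp_eq_one_of_logDeriv hE hE₀ hne hL₀ hL hw),
      ← Complex.exp_neg, Complex.norm_exp, Complex.neg_re]
  have hL_nonneg : ∀ n, 0 ≤ coeff n (mk fun n => coeff (n - 1) S / n) := fun n => by
    rw [coeff_mk]
    exact div_nonneg (hS_nonneg _) n.cast_nonneg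
  rw [hnorm z hz, hnorm ‖z‖ (by simpa using hz)]
  refine Real.exp_le_exp.2 (neg_le_neg ?_)
  exact (Complex.re_le_norm _).trans (hLS.norm_le_re_norm hL_nonneg hz)

/-- `Λ > 0` is a zero of `E`, and no zero of `E` has smaller modulus. -/
structure IsFirstZero (E : ℂ → ℂ) (Λ : ℝ) : Prop where
  pos : 0 < Λ
  apply_eq_zero : E Λ = 0
  apply_ne_zero : ∀ z ∈ ball (0 : ℂ) Λ, E z ≠ 0

theorem apply_norm_eq_zero_of_minimal_norm {E : ℂ → ℂ} (hE : Continuous E) {w : ℂ} (hw : E w = 0)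
    (hle : ∀ z ∈ ball (0 : ℂ) ‖w‖, ‖E ‖z‖‖ ≤ ‖E z‖) : E ‖w‖ = 0 := by
  rcases eq_or_ne w 0 with rfl | hw₀
  · simpa using hw
  have hmem : w ∈ closure (ball (0 : ℂ) ‖w‖) := by
    rw [closure_ball _ (norm_ne_zero_iff.2 hw₀)]
    simp
  have hclosed : IsClosed {z : ℂ | ‖E ‖z‖‖ ≤ ‖E z‖} :=
    isClosed_le (by fun_prop) (by fun_prop)
  have hEw : ‖E ‖w‖‖ ≤ ‖E w‖ := hclosed.closure_subset_iff.2 hle hmem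
  rwa [hw, norm_zero, norm_le_zero_iff] at hEw

theorem exists_isFirstZero (hF : HasGeometricLogDeriv F) (hE₀ : E 0 = 1)
    (hE : ∀ R, HasPowerSeriesOnDisk E (F.map Complex.ofRealHom) R) : ∃ Λ, IsFirstZero E Λ := by
  have hd := differentiable_of_hasPowerSeriesOnDisk hE
  obtain ⟨w, hw, hne⟩ :=
    exists_zero_of_minimal_norm hd.continuous (exists_zero_of_hasGeometricLogDeriv hF hE)
  obtain ⟨S, v, hFS, hv, hS⟩ := hF
  have hw₀ : w ≠ 0 := by
    rintro rfl
    exact one_ne_zero (hE₀.symm.trans hw)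
  refine ⟨‖w‖, norm_pos_iff.2 hw₀, apply_norm_eq_zero_of_minimal_norm hd.continuous hw
    fun z hz => ?_, hne⟩
  exact norm_apply_norm_le_norm hd.differentiableOn hE₀ hne (neg_logDeriv_of_ofReal (hE _) hFS hne)
    (fun n => (pow_nonneg hv.le _).trans (hS n)) hz

-- Rolle's theorem for `x ^ k * E x`, which vanishes at `0` and `Λ`.
theorem IsFirstZero.exists_neg_mul_logDeriv_eq {Λ k : ℝ} (hΛ : IsFirstZero E Λ)
    (hE : Differentiable ℂ E) (hE_real : ∀ x : ℝ, ((E x).re : ℂ) = E x) (hk : 0 < k) :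
    ∃ x ∈ Ioo 0 Λ, (x * -logDeriv E x : ℂ).re = k := by
  have hcont : Continuous fun x : ℝ => x ^ k * (E x).re := by
    have := hE.continuous
    exact (Real.continuous_rpow_const hk.le).mul (by fun_prop)
  have hderiv : ∀ x ∈ Ioo 0 Λ, HasDerivAt (fun x : ℝ => x ^ k * (E x).re)
      (k * x ^ (k - 1) * (E x).re + x ^ k * (deriv E x).re) x := fun x hx =>
    (Real.hasDerivAt_rpow_const (Or.inl hx.1.ne')).mul (hE x).hasDerivAt.real_of_complex
  obtain ⟨x, hx, hzero⟩ := exists_hasDerivAt_eq_zero hΛ.pos hcont.continuousOn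
    (by simp [hΛ.apply_eq_zero, Real.zero_rpow hk.ne']) hderiv
  refine ⟨x, hx, ?_⟩
  have hne : E x ≠ 0 := hΛ.apply_ne_zero x (by simpa [abs_of_pos hx.1] using hx.2)
  have hre : (E x).re ≠ 0 := fun h => hne (by rw [← hE_real, h, Complex.ofReal_zero])
  have hxk : x ^ k = x ^ (k - 1) * x := by rw [← Real.rpow_add_one hx.1.ne', sub_add_cancel]
  have hxpow : x ^ (k - 1) ≠ 0 := (Real.rpow_pos_of_pos hx.1 _).ne'
  have hcrit : x * (deriv E x).re = -(k * (E x).re) := by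
    refine mul_left_cancel₀ hxpow ?_
    rw [hxk] at hzero
    linear_combination hzero
  rw [logDeriv_apply, ← hE_real x, Complex.re_ofReal_mul, Complex.neg_re, Complex.div_ofReal_re,
    mul_neg, mul_div_assoc', hcrit, neg_div, neg_neg, mul_div_cancel_right₀ _ hre]

end FirstZero

section ConvexRadius

open PowerSeries

/-- On the disk `|z| < r` the function `f` is `z * q z` with `q` zero-free, and
`S = -z q' / q = 1 - z f' / f` has the power series `F`, with nonnegative
coefficients and no constant term. -/
structure HasNonnegLogDeriv (f q S : ℂ → ℂ) (F : ℝ⟦X⟧) (r : ℝ) : Prop where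
  apply_eq : ∀ z, f z = z * q z
  differentiableOn : DifferentiableOn ℂ q (ball 0 r)
  ne_zero : ∀ z ∈ ball (0 : ℂ) r, q z ≠ 0
  mul_deriv : ∀ z ∈ ball (0 : ℂ) r, z * deriv q z = -(S z * q z)
  hasPowerSeriesOnDisk : HasPowerSeriesOnDisk S (F.map Complex.ofRealHom) r
  coeff_nonneg : ∀ n, 0 ≤ coeff n F
  coeff_zero : coeff 0 F = 0

/-- The real function whose sign on `[0, r)` is that of `(x f''(x) + β f'(x)) / q(x)` when
`f = z q` and `S = -z q' / q`. -/
def convexityDefect (S : ℂ → ℂ) (β x : ℝ) : ℝ :=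
  (β - (S x).re) * (1 - (S x).re) - (x * deriv S x).re

/-- The `𝒞(φ)`-radius of `f` is the smallest positive root of `r f''(r) + β f'(r)`, and it is
smaller than `ℓ`. -/
def ConvexRadiusIsLeastRoot (φ f : ℂ → ℂ) (β ℓ : ℝ) : Prop :=
  ∃ R : ℝ, IsLeast {r : ℝ | 0 < r ∧ (r : ℂ) * deriv (deriv f) r + (β : ℂ) * deriv f r = 0} R ∧
    R < ℓ ∧ MaMindaBessel.IsConvexRadius φ f R

theorem exists_first_zero_of_continuousOn {ψ : ℝ → ℝ} {y : ℝ} (hψ : ContinuousOn ψ (Icc 0 y))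
    (hy : 0 ≤ y) (hψ₀ : 0 < ψ 0) (hψy : ψ y < 0) :
    ∃ R ∈ Ioo 0 y, ψ R = 0 ∧ ∀ x ∈ Ico 0 R, 0 < ψ x := by
  have hcompact : IsCompact (Icc 0 y ∩ ψ ⁻¹' {0}) :=
    isCompact_Icc.of_isClosed_subset (hψ.preimage_isClosed_of_isClosed isClosed_Icc
      isClosed_singleton) inter_subset_left
  obtain ⟨x, hx, hψx⟩ := intermediate_value_Icc' hy hψ ⟨hψy.le, hψ₀.le⟩
  obtain ⟨R, ⟨hR, hψR⟩, hmin⟩ := hcompact.exists_isLeast ⟨x, hx, hψx⟩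
  have hR₀ : R ≠ 0 := by
    rintro rfl
    exact hψ₀.ne' hψR
  have hRy : R ≠ y := by
    rintro rfl
    exact hψy.ne hψR
  refine ⟨R, ⟨hR.1.lt_of_ne' hR₀, hR.2.lt_of_ne hRy⟩, hψR, fun x hx => ?_⟩
  by_contra! hneg
  have hxy : x ≤ y := hx.2.le.trans hR.2
  obtain ⟨t, ht, hψt⟩ := intermediate_value_Icc' hx.1 (hψ.mono (Icc_subset_Icc_right hxy))
    ⟨hneg, hψ₀.le⟩
  exact (hmin ⟨⟨ht.1, ht.2.trans hxy⟩, hψt⟩).not_gt (ht.2.trans_lt hx.2)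

theorem ofReal_mem_ball {x r : ℝ} (hx : 0 ≤ x) (hxr : x < r) : (x : ℂ) ∈ ball (0 : ℂ) r := by
  simpa [abs_of_nonneg hx] using hxr

namespace HasNonnegLogDeriv

variable {f q S : ℂ → ℂ} {F : ℝ⟦X⟧} {r x : ℝ} {z : ℂ}

theorem deriv_eq (h : HasNonnegLogDeriv f q S F r) (hz : z ∈ ball 0 r) :
    deriv f z = q z * (1 - S z) := by
  have hq := (h.differentiableOn.differentiableAt (isOpen_ball.mem_nhds hz)).hasDerivAt
  rw [funext h.apply_eq, ((hasDerivAt_id' z).fun_mul hq).deriv]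
  linear_combination h.mul_deriv z hz

theorem mul_deriv_deriv_eq (h : HasNonnegLogDeriv f q S F r) (hz : z ∈ ball 0 r) :
    z * deriv (deriv f) z = -(q z * (S z * (1 - S z) + z * deriv S z)) := by
  have hnhds := isOpen_ball.mem_nhds hz
  have hq := (h.differentiableOn.differentiableAt hnhds).hasDerivAt
  have hS := (h.hasPowerSeriesOnDisk.differentiableOn.differentiableAt hnhds).hasDerivAt
  have heq : deriv f =ᶠ[𝓝 z] fun w => q w * (1 - S w) := by
    filter_upwards [hnhds] with w hw using h.deriv_eq hw
  rw [heq.deriv_eq, (hq.fun_mul (hS.const_sub 1)).deriv]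
  linear_combination (1 - S z) * h.mul_deriv z hz

theorem hasPowerSeriesOnDisk_mul_deriv (h : HasNonnegLogDeriv f q S F r) :
    HasPowerSeriesOnDisk (fun z => z * deriv S z)
      ((X * d⁄dX ℝ F).map Complex.ofRealHom) r := by
  rw [map_mul, map_X, map_ofReal_derivative]
  exact h.hasPowerSeriesOnDisk.deriv.id_mul

theorem coeff_le_coeff_X_mul_derivative (h : HasNonnegLogDeriv f q S F r) (n : ℕ) :
    coeff n F ≤ coeff n (X * d⁄dX ℝ F) := by
  rw [coeff_X_mul_derivative]
  rcases n.eq_zero_or_pos with rfl | hn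
  · simp [h.coeff_zero]
  · exact le_mul_of_one_le_left (h.coeff_nonneg n) (by exact_mod_cast hn)

theorem coeff_X_mul_derivative_nonneg (h : HasNonnegLogDeriv f q S F r) (n : ℕ) :
    0 ≤ coeff n (X * d⁄dX ℝ F) :=
  (h.coeff_nonneg n).trans (h.coeff_le_coeff_X_mul_derivative n)

theorem re_le_re_mul_deriv (h : HasNonnegLogDeriv f q S F r) (hx : 0 ≤ x) (hxr : x < r) :
    (S x).re ≤ (x * deriv S x).re :=
  h.hasPowerSeriesOnDisk.re_le_re_of_coeff_le h.hasPowerSeriesOnDisk_mul_deriv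
    h.coeff_le_coeff_X_mul_derivative hx hxr

theorem apply_zero (h : HasNonnegLogDeriv f q S F r) (hr : 0 < r) : S 0 = 0 := by
  have hS := h.mul_deriv 0 (mem_ball_self hr)
  simpa [h.ne_zero 0 (mem_ball_self hr)] using hS

theorem mul_deriv_deriv_add_eq (h : HasNonnegLogDeriv f q S F r) (β : ℝ) (hx : 0 ≤ x)
    (hxr : x < r) : (x : ℂ) * deriv (deriv f) x + (β : ℂ) * deriv f x =
      q x * convexityDefect S β x := by
  have hmem := ofReal_mem_ball hx hxr
  rw [h.mul_deriv_deriv_eq hmem, h.deriv_eq hmem, convexityDefect]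
  push_cast
  rw [h.hasPowerSeriesOnDisk.ofReal_re hmem, h.hasPowerSeriesOnDisk_mul_deriv.ofReal_re hmem]
  ring

theorem continuousOn_convexityDefect (h : HasNonnegLogDeriv f q S F r) (β : ℝ) :
    ContinuousOn (convexityDefect S β) (Ico 0 r) := by
  have hmaps : MapsTo (fun x : ℝ => (x : ℂ)) (Ico 0 r) (ball 0 r) :=
    fun x hx => ofReal_mem_ball hx.1 hx.2
  have hre : ∀ {g : ℂ → ℂ}, DifferentiableOn ℂ g (ball 0 r) →
      ContinuousOn (fun x : ℝ => (g x).re) (Ico 0 r) := fun hg =>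
    Complex.continuous_re.comp_continuousOn
      (hg.continuousOn.comp Complex.continuous_ofReal.continuousOn hmaps)
  have hS := hre h.hasPowerSeriesOnDisk.differentiableOn
  exact ((continuousOn_const.sub hS).mul (continuousOn_const.sub hS)).sub
    (hre h.hasPowerSeriesOnDisk_mul_deriv.differentiableOn)

theorem exists_first_zero_convexityDefect (h : HasNonnegLogDeriv f q S F r) {β y : ℝ} (hβ : 0 < β)
    (hy : y ∈ Ioo 0 r) (hSy : (S y).re = 1) :
    ∃ R ∈ Ioo 0 r, convexityDefect S β R = 0 ∧
      ∀ x ∈ Ico 0 R, (S x).re < 1 ∧ 0 < convexityDefect S β x := by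
  have hneg : ∀ x ∈ Ioo 0 r, (S x).re = 1 → convexityDefect S β x < 0 := fun x hx hSx => by
    have := h.re_le_re_mul_deriv hx.1.le hx.2
    rw [convexityDefect, hSx, sub_self, mul_zero]
    linarith
  have hψ₀ : 0 < convexityDefect S β 0 := by
    simpa [convexityDefect, h.apply_zero (hy.1.trans hy.2)] using hβ
  obtain ⟨R, hR, hψR, hpos⟩ := exists_first_zero_of_continuousOn
    ((h.continuousOn_convexityDefect β).mono (Icc_subset_Ico_right hy.2)) hy.1.le hψ₀
    (hneg y hy hSy)
  refine ⟨R, ⟨hR.1, hR.2.trans hy.2⟩, hψR, fun x hx => ⟨?_, hpos x hx⟩⟩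
  have hxy : x ≤ y := (hx.2.trans hR.2).le
  have hSx : (S x).re ≤ 1 :=
    hSy ▸ h.hasPowerSeriesOnDisk.re_le_re h.coeff_nonneg hx.1 hxy hy.2
  refine hSx.lt_of_ne fun hSx => ?_
  rcases hx.1.eq_or_lt with rfl | hx₀
  · simp [h.apply_zero (hy.1.trans hy.2)] at hSx
  · exact (hpos x hx).not_gt (hneg x ⟨hx₀, hxy.trans_lt hy.2⟩ hSx)

theorem norm_mul_deriv_deriv_div_deriv_lt (h : HasNonnegLogDeriv f q S F r) {β : ℝ}
    (hz : z ∈ ball 0 r) (hS : (S ‖z‖).re < 1) (hψ : 0 < convexityDefect S β ‖z‖) :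
    deriv f z ≠ 0 ∧ ‖z * deriv (deriv f) z / deriv f z‖ < β := by
  set s := (S ‖z‖).re
  set d := (‖z‖ * deriv S ‖z‖ : ℂ).re
  have hSz : ‖S z‖ ≤ s := h.hasPowerSeriesOnDisk.norm_le_re_norm h.coeff_nonneg hz
  have hDz : ‖z * deriv S z‖ ≤ d :=
    h.hasPowerSeriesOnDisk_mul_deriv.norm_le_re_norm h.coeff_X_mul_derivative_nonneg hz
  have hd_nonneg : 0 ≤ d := (norm_nonneg _).trans hDz
  have hle : 1 - s ≤ ‖1 - S z‖ := by
    have := norm_sub_norm_le (1 : ℂ) (S z)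
    rw [norm_one] at this
    linarith
  have hs_pos : 0 < 1 - s := sub_pos.2 hS
  have hne : 1 - S z ≠ 0 := norm_pos_iff.1 (hs_pos.trans_le hle)
  have hq := h.ne_zero z hz
  have heq : z * deriv (deriv f) z / deriv f z = -(S z + z * deriv S z / (1 - S z)) := by
    rw [h.mul_deriv_deriv_eq hz, h.deriv_eq hz]
    field_simp
  refine ⟨by rw [h.deriv_eq hz]; exact mul_ne_zero hq hne, ?_⟩
  calc ‖z * deriv (deriv f) z / deriv f z‖
      ≤ ‖S z‖ + ‖z * deriv S z‖ / ‖1 - S z‖ := by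
        rw [heq, norm_neg, ← norm_div]
        exact norm_add_le _ _
    _ ≤ s + d / (1 - s) := by gcongr
    _ < β := by
        rw [← lt_sub_iff_add_lt', div_lt_iff₀ hs_pos]
        exact sub_pos.1 hψ

theorem convexRadiusIsLeastRoot (h : HasNonnegLogDeriv f q S F r) {φ : ℂ → ℂ} {β y : ℝ}
    (hβ : 0 < β) (hball : ball (1 : ℂ) β ⊆ φ '' ball 0 1) (hbdry : 1 - (β : ℂ) ∉ φ '' ball 0 1)
    (hy : y ∈ Ioo 0 r) (hSy : (S y).re = 1) : ConvexRadiusIsLeastRoot φ f β r := by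
  obtain ⟨R, hR, hψR, hlt⟩ := h.exists_first_zero_convexityDefect hβ hy hSy
  have hroot : (R : ℂ) * deriv (deriv f) R + β * deriv f R = 0 := by
    rw [h.mul_deriv_deriv_add_eq β hR.1.le hR.2, hψR, Complex.ofReal_zero, mul_zero]
  have hmem : R ∈ MaMindaBessel.convexRadii φ f := by
    refine ⟨hR.1, fun z hz => ?_⟩
    obtain ⟨hSz, hψz⟩ := hlt ‖z‖ ⟨norm_nonneg z, mem_ball_zero_iff.1 hz⟩
    obtain ⟨hne, hnorm⟩ :=
      h.norm_mul_deriv_deriv_div_deriv_lt (ball_subset_ball hR.2.le hz) hSz hψz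
    exact ⟨hne, hball (by rwa [mem_ball, dist_eq_norm, add_sub_cancel_left])⟩
  refine ⟨R, ⟨⟨hR.1, hroot⟩, fun x hx => ?_⟩, hR.2, ⟨R, hmem⟩,
    IsGreatest.isLUB ⟨hmem, fun ρ hρ => ?_⟩⟩
  · by_contra! hxR
    have hxr := hxR.trans hR.2
    have hx_root := hx.2
    rw [h.mul_deriv_deriv_add_eq β hx.1.le hxr] at hx_root
    have hq := h.ne_zero x (ofReal_mem_ball hx.1.le hxr)
    exact (hlt x ⟨hx.1.le, hxR⟩).2.ne'
      (Complex.ofReal_eq_zero.1 ((mul_eq_zero.1 hx_root).resolve_left hq))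
  · by_contra! hRρ
    obtain ⟨hne, hin⟩ := hρ.2 R (ofReal_mem_ball hR.1.le hRρ)
    rw [(div_eq_iff hne).2 (show _ = -(β : ℂ) * _ by linear_combination hroot),
      ← sub_eq_add_neg] at hin
    exact hbdry hin

end HasNonnegLogDeriv

theorem hasNonnegLogDeriv_of_mul_deriv {E f q : ℂ → ℂ} {F S : ℝ⟦X⟧} {p : ℕ} {A r : ℝ}
    (hp : p ≠ 0) (hA : 0 ≤ A) (hE_ne : ∀ z ∈ ball (0 : ℂ) (r ^ p), E z ≠ 0)
    (hE : HasPowerSeriesOnDisk E (F.map Complex.ofRealHom) (r ^ p))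
    (hFS : d⁄dX ℝ F = -(S * F)) (hS : ∀ n, 0 ≤ coeff n S) (hf : ∀ z, f z = z * q z)
    (hq : DifferentiableOn ℂ q (ball 0 r)) (hq_ne : ∀ z ∈ ball (0 : ℂ) r, q z ≠ 0)
    (hq_deriv : ∀ z ∈ ball (0 : ℂ) r, z * deriv q z = A * (z ^ p * logDeriv E (z ^ p)) * q z) :
    HasNonnegLogDeriv f q (fun z => A * (z ^ p * -logDeriv E (z ^ p)))
      (C A * expand p hp (X * S)) r where
  apply_eq := hf
  differentiableOn := hq
  ne_zero := hq_ne
  mul_deriv z hz := by rw [hq_deriv z hz]; ring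
  hasPowerSeriesOnDisk := by
    have hlog := ((neg_logDeriv_of_ofReal hE hFS hE_ne).id_mul.comp_pow hp).const_mul A
    simpa only [map_mul, map_C, map_X, map_expand, Complex.ofRealHom_eq_coe] using hlog
  coeff_nonneg n := by
    rw [coeff_C_mul, coeff_expand]
    refine mul_nonneg hA ?_
    split_ifs
    · exact coeff_mul_nonneg (fun k => by rw [coeff_X]; split_ifs <;> simp) hS _
    · exact le_rfl
  coeff_zero := by
    rw [coeff_C_mul, coeff_expand, if_pos (dvd_zero p), Nat.zero_div, coeff_zero_X_mul, mul_zero]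

theorem convexRadiusIsLeastRoot_of_isFirstZero {E f q φ : ℂ → ℂ} {F : ℝ⟦X⟧} {p : ℕ} {A r β : ℝ}
    (hp : p ≠ 0) (hA : 0 < A) (hr : 0 < r) (hΛ : IsFirstZero E (r ^ p))
    (hE : ∀ R, HasPowerSeriesOnDisk E (F.map Complex.ofRealHom) R) (hF : HasGeometricLogDeriv F)
    (hf : ∀ z, f z = z * q z)
    (hq : DifferentiableOn ℂ q (ball 0 r)) (hq_ne : ∀ z ∈ ball (0 : ℂ) r, q z ≠ 0)
    (hq_deriv : ∀ z ∈ ball (0 : ℂ) r, z * deriv q z = A * (z ^ p * logDeriv E (z ^ p)) * q z)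
    (hβ : 0 < β) (hball : ball (1 : ℂ) β ⊆ φ '' ball 0 1)
    (hbdry : 1 - (β : ℂ) ∉ φ '' ball 0 1) : ConvexRadiusIsLeastRoot φ f β r := by
  obtain ⟨S, v, hFS, hv, hS⟩ := hF
  have hS_nonneg : ∀ n, 0 ≤ coeff n S := fun n => (pow_nonneg hv.le _).trans (hS n)
  obtain ⟨x, hx, hSx⟩ := hΛ.exists_neg_mul_logDeriv_eq (k := A⁻¹)
    (differentiable_of_hasPowerSeriesOnDisk hE)
    (fun x => (hE (|x| + 1)).ofReal_re (by simp)) (inv_pos.2 hA)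
  have hroot : (x ^ (p⁻¹ : ℝ)) ^ p = x := Real.rpow_inv_natCast_pow hx.1.le hp
  have hroot_mem : x ^ (p⁻¹ : ℝ) ∈ Ioo 0 r :=
    ⟨Real.rpow_pos_of_pos hx.1 _, lt_of_pow_lt_pow_left₀ p hr.le (hroot.trans_lt hx.2)⟩
  refine (hasNonnegLogDeriv_of_mul_deriv hp hA.le hΛ.apply_ne_zero (hE _) hFS hS_nonneg hf hq
    hq_ne hq_deriv).convexRadiusIsLeastRoot hβ hball hbdry hroot_mem ?_
  rw [← Complex.ofReal_pow, hroot, Complex.re_ofReal_mul, hSx, mul_inv_cancel₀ hA.ne']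

end ConvexRadius

section InjectiveHolomorphic

variable {φ : ℂ → ℂ} {U : Set ℂ}

theorem isOpen_image_of_injOn (hφ : DifferentiableOn ℂ φ U) (hinj : InjOn φ U) (hU : IsOpen U) :
    IsOpen (φ '' U) := by
  refine isOpen_iff_mem_nhds.2 ?_
  rintro _ ⟨z, hz, rfl⟩
  have hUz := hU.mem_nhds hz
  rcases (hφ.analyticAt hUz).eventually_constant_or_nhds_le_map_nhds with hconst | hopen
  · obtain ⟨w, ⟨hwz, hwU⟩, hw⟩ := (((hconst.and hUz).filter_mono nhdsWithin_le_nhds).and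
      (self_mem_nhdsWithin (s := {z}ᶜ))).exists
    exact absurd (hinj hwU hz hwz) hw
  · exact hopen (image_mem_map hUz)

theorem notMem_image_of_tendsto {ι : Type*} {l : Filter ι} [l.NeBot] {u : ι → ℂ} {ζ w : ℂ}
    (hφ : DifferentiableOn ℂ φ U) (hinj : InjOn φ U) (hU : IsOpen U) (hζ : ζ ∉ U)
    (hu : ∀ᶠ i in l, u i ∈ U) (huζ : Tendsto u l (𝓝 ζ)) (hφu : Tendsto (φ ∘ u) l (𝓝 w)) :
    w ∉ φ '' U := by
  rintro ⟨z, hz, rfl⟩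
  obtain ⟨V, W, hV, hW, hzV, hζW, hVW⟩ := t2_separation (ne_of_mem_of_not_mem hz hζ)
  have hopen : IsOpen (φ '' (U ∩ V)) := isOpen_image_of_injOn (hφ.mono inter_subset_left)
    (hinj.mono inter_subset_left) (hU.inter hV)
  obtain ⟨i, hiU, hiW, y, hy, hyi⟩ := (hu.and ((huζ.eventually_mem (hW.mem_nhds hζW)).and
    (hφu.eventually_mem (hopen.mem_nhds ⟨z, ⟨hz, hzV⟩, rfl⟩)))).exists
  exact disjoint_left.1 hVW hy.2 (hinj hy.1 hiU hyi ▸ hiW)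

theorem notMem_image_of_tendsto_neg_one {w : ℂ} (hφ : DifferentiableOn ℂ φ (ball 0 1))
    (hinj : InjOn φ (ball 0 1)) (hw : Tendsto (fun x : ℝ => φ x) (𝓝[>] (-1)) (𝓝 w)) :
    w ∉ φ '' ball 0 1 := by
  refine notMem_image_of_tendsto (u := Complex.ofReal) (ζ := (-1 : ℝ)) hφ hinj isOpen_ball
    (by simp) ?_ (Complex.continuous_ofReal.continuousAt.mono_left nhdsWithin_le_nhds) hw
  filter_upwards [Ioo_mem_nhdsGT (show (-1 : ℝ) < 1 by norm_num)] with x hx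
  simpa using abs_lt.2 hx

theorem pos_of_isGreatest_ball_subset_image {z w : ℂ} {β : ℝ} (hφ : DifferentiableOn ℂ φ U)
    (hinj : InjOn φ U) (hU : IsOpen U) (hz : z ∈ U) (hzw : φ z = w)
    (hβ : IsGreatest {ρ : ℝ | ball w ρ ⊆ φ '' U} β) : 0 < β := by
  obtain ⟨ε, hε, hsub⟩ := Metric.isOpen_iff.1 (isOpen_image_of_injOn hφ hinj hU) w ⟨z, hz, hzw⟩
  exact hε.trans_le (hβ.2 hsub)

end InjectiveHolomorphic

section NormalizedN

open PowerSeries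
open MaMindaBessel (Q E logE fFun gFun hFun besselN)

variable {a b c ν x y : ℝ}

/-- The power series in `w` of `E a b c ν w`, obtained from that of the normalized Bessel function
by multiplying the coefficients with `Q(2n + ν) / Q(ν)`. -/
def ESeries (a b c ν : ℝ) : ℝ⟦X⟧ :=
  mk fun n => Q a b c (2 * n + ν) / Q a b c ν * PowerSeries.coeff n (besselSeries ν)

theorem hasGeometricLogDeriv_ESeries_of_nonneg (hν : -1 < ν) (hQ : Q a b c ν ≠ 0)
    (ha : 0 ≤ a * Q a b c ν) (hba : 0 ≤ (b - a) * Q a b c ν) :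
    HasGeometricLogDeriv (ESeries a b c ν) := by
  have hp : 0 ≤ 2 * ((b - a) / Q a b c ν) :=
    mul_nonneg zero_le_two (div_nonneg_iff.2 (mul_nonneg_iff.1 hba))
  have ht : 0 ≤ a / Q a b c ν := div_nonneg_iff.2 (mul_nonneg_iff.1 ha)
  convert (hasGeometricLogDeriv_besselSeries hν).add_X_mul_derivative_sub_X_mul hp ht using 1
  ext n
  rw [map_sub, map_add, coeff_C_mul, coeff_C_mul, coeff_X_mul_derivative,
    coeff_X_mul_besselSeries hν, ESeries, coeff_mk]
  field_simp
  rw [Q, Q]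
  ring

theorem hasGeometricLogDeriv_ESeries_of_eq_mul (hν : -1 < ν) (hQ : Q a b c ν ≠ 0)
    (hxy : ∀ z, Q a b c z = a * (z - x) * (z - y)) (hx : x ≤ ν) (hy : y ≤ ν) :
    HasGeometricLogDeriv (ESeries a b c ν) := by
  obtain ⟨⟨ha, hνx⟩, hνy⟩ : (a ≠ 0 ∧ ν - x ≠ 0) ∧ ν - y ≠ 0 := by
    rw [← mul_ne_zero_iff, ← mul_ne_zero_iff, ← hxy]
    exact hQ
  have hpx : 0 ≤ 2 / (ν - x) := div_nonneg zero_le_two (sub_nonneg.2 hx)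
  have hpy : 0 ≤ 2 / (ν - y) := div_nonneg zero_le_two (sub_nonneg.2 hy)
  convert ((hasGeometricLogDeriv_besselSeries hν).add_X_mul_derivative hpx).add_X_mul_derivative hpy
    using 1
  ext n
  simp only [map_add (PowerSeries.coeff _), coeff_C_mul, coeff_X_mul_derivative, ESeries, coeff_mk,
    hxy]
  field_simp
  ring

theorem exists_Q_eq_mul (ha : a ≠ 0) (hdisc : 0 ≤ discrim a (b - a) c) :
    ∃ x y, ∀ z, Q a b c z = a * (z - x) * (z - y) := by
  obtain ⟨s, hs⟩ : ∃ s, discrim a (b - a) c = s ^ 2 := ⟨√_, (Real.sq_sqrt hdisc).symm⟩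
  rw [discrim] at hs
  refine ⟨(a - b + s) / (2 * a), (a - b - s) / (2 * a), fun z => ?_⟩
  rw [Q]
  field_simp
  linear_combination -hs

theorem roots_le_of_Q_eq_mul (hν₀ : ∀ x, Q a b c x = 0 → x ≤ ν)
    (hxy : ∀ z, Q a b c z = a * (z - x) * (z - y)) : x ≤ ν ∧ y ≤ ν :=
  ⟨hν₀ x (by rw [hxy]; ring), hν₀ y (by rw [hxy]; ring)⟩

theorem mul_Q_nonneg (hν₀ : ∀ x, Q a b c x = 0 → x ≤ ν) : 0 ≤ a * Q a b c ν := by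
  rcases eq_or_ne a 0 with rfl | ha
  · rw [zero_mul]
  by_contra! hneg
  have hdisc : 0 ≤ discrim a (b - a) c := by
    have hsq : (2 * a * ν + (b - a)) ^ 2 = discrim a (b - a) c + 4 * (a * Q a b c ν) := by
      rw [discrim, Q]
      ring
    linarith [sq_nonneg (2 * a * ν + (b - a))]
  obtain ⟨x, y, hxy⟩ := exists_Q_eq_mul ha hdisc
  obtain ⟨hx, hy⟩ := roots_le_of_Q_eq_mul hν₀ hxy
  have : 0 ≤ a ^ 2 * ((ν - x) * (ν - y)) :=
    mul_nonneg (sq_nonneg a) (mul_nonneg (sub_nonneg.2 hx) (sub_nonneg.2 hy))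
  rw [hxy] at hneg
  linarith

theorem sub_mul_Q_nonneg (hν₀ : ∀ x, Q a b c x = 0 → x ≤ ν) (hab : 0 ≤ a * (b - a)) :
    0 ≤ (b - a) * Q a b c ν := by
  rcases eq_or_ne a 0 with rfl | ha
  · rcases eq_or_ne b 0 with rfl | hb
    · simp
    have hroot : -c / b ≤ ν := hν₀ _ (by rw [Q]; field_simp; ring)
    calc 0 ≤ b ^ 2 * (ν - -c / b) := mul_nonneg (sq_nonneg b) (sub_nonneg.2 hroot)
      _ = (b - 0) * Q 0 b c ν := by rw [Q]; field_simp; ring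
  · refine nonneg_of_mul_nonneg_right (?_ : 0 ≤ a ^ 2 * _) (by positivity)
    calc 0 ≤ a * (b - a) * (a * Q a b c ν) := mul_nonneg hab (mul_Q_nonneg hν₀)
      _ = a ^ 2 * ((b - a) * Q a b c ν) := by ring

theorem hasGeometricLogDeriv_ESeries (habc : 0 ≤ a * (b - a) ∨ 0 ≤ discrim a (b - a) c)
    (hν : -1 < ν) (hν₀ : ∀ x, Q a b c x = 0 → x ≤ ν) (hQ : Q a b c ν ≠ 0) :
    HasGeometricLogDeriv (ESeries a b c ν) := by
  by_cases hab : 0 ≤ a * (b - a)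
  · exact hasGeometricLogDeriv_ESeries_of_nonneg hν hQ (mul_Q_nonneg hν₀) (sub_mul_Q_nonneg hν₀ hab)
  · have ha : a ≠ 0 := by
      rintro rfl
      simp at hab
    obtain ⟨x, y, hxy⟩ := exists_Q_eq_mul ha (habc.resolve_left hab)
    obtain ⟨hx, hy⟩ := roots_le_of_Q_eq_mul hν₀ hxy
    exact hasGeometricLogDeriv_ESeries_of_eq_mul hν hQ hxy hx hy

theorem hasPowerSeriesOnDisk_E (hν : 0 ≤ ν) (hQ : Q a b c ν ≠ 0) (R : ℝ) :
    HasPowerSeriesOnDisk (E a b c ν) ((ESeries a b c ν).map Complex.ofRealHom) R := fun w _ => by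
  obtain ⟨z, rfl⟩ := IsAlgClosed.exists_pow_nat_eq w two_pos
  rw [MaMindaBessel.E_sq hν hQ]
  refine (MaMindaBessel.hasSum_E hν hQ z).congr_fun fun n => ?_
  rw [coeff_map, ESeries, coeff_mk, besselSeries, coeff_mk, Complex.ofRealHom_eq_coe, div_pow]
  push_cast
  ring

theorem exists_isFirstZero_E (hF : HasGeometricLogDeriv (ESeries a b c ν)) (hν : 0 ≤ ν)
    (hQ : Q a b c ν ≠ 0) :
    ∃ lam, 0 < lam ∧ IsFirstZero (E a b c ν) (lam ^ 2) := by
  obtain ⟨Λ, hΛ⟩ :=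
    exists_isFirstZero hF (MaMindaBessel.E_zero hν hQ) (hasPowerSeriesOnDisk_E hν hQ)
  exact ⟨√Λ, Real.sqrt_pos.2 hΛ.pos, by rwa [Real.sq_sqrt hΛ.pos.le]⟩

theorem besselN_eq_zero_iff (hν : 0 ≤ ν) (hQ : Q a b c ν ≠ 0) (hx : 0 < x) :
    besselN a b c ν x = 0 ↔ E a b c ν ((x : ℂ) ^ 2) = 0 := by
  have heq := MaMindaBessel.besselN_eq hν hQ (Complex.ofReal_mem_slitPlane.2 hx)
  have hfactor : ((2 ^ ν * Real.Gamma (ν + 1) / Q a b c ν : ℝ) : ℂ) ≠ 0 := by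
    have hΓ := Real.Gamma_pos_of_pos (by positivity : 0 < ν + 1)
    exact_mod_cast div_ne_zero (mul_pos (by positivity) hΓ).ne' hQ
  have hpow : (x : ℂ) ^ (ν : ℂ) ≠ 0 := by
    simp [Complex.cpow_eq_zero_iff, hx.ne']
  rw [← mul_eq_zero_iff_left hfactor, heq, mul_eq_zero_iff_left hpow]

theorem isLeast_zeros_besselN (hν : 0 ≤ ν) (hQ : Q a b c ν ≠ 0) {lam : ℝ} (hlam : 0 < lam)
    (hE : IsFirstZero (E a b c ν) (lam ^ 2)) :
    IsLeast {x : ℝ | 0 < x ∧ besselN a b c ν x = 0} lam := by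
  refine ⟨⟨hlam, (besselN_eq_zero_iff hν hQ hlam).2 (by exact_mod_cast hE.apply_eq_zero)⟩, ?_⟩
  rintro x ⟨hx, hNx⟩
  by_contra! hlt
  refine hE.apply_ne_zero ((x : ℂ) ^ 2) ?_ ((besselN_eq_zero_iff hν hQ hx).1 hNx)
  rw [← Complex.ofReal_pow]
  exact ofReal_mem_ball (sq_nonneg x) (by gcongr)

theorem mul_deriv_comp_sq {g : ℂ → ℂ} (hg : Differentiable ℂ g) {z : ℂ} (hz : g (z ^ 2) ≠ 0) :
    z * deriv (fun z => g (z ^ 2)) z = 2 * (z ^ 2 * logDeriv g (z ^ 2)) * g (z ^ 2) := by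
  have hderiv := (hg (z ^ 2)).hasDerivAt.comp z (_root_.hasDerivAt_pow 2 z)
  rw [Function.comp_def] at hderiv
  rw [hderiv.deriv, logDeriv_apply]
  field_simp
  ring

theorem mul_deriv_exp_logE_div (hν : 0 ≤ ν) (hQ : Q a b c ν ≠ 0) {ρ : ℝ}
    (hne : ∀ z ∈ ball (0 : ℂ) ρ, E a b c ν (z ^ 2) ≠ 0) {z : ℂ} (hz : z ∈ ball (0 : ℂ) ρ) :
    z * deriv (fun z => Complex.exp (logE a b c ν z / ν)) z =
      2 / ν * (z ^ 2 * logDeriv (E a b c ν) (z ^ 2)) * Complex.exp (logE a b c ν z / ν) := by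
  obtain ⟨hd, hexp⟩ := MaMindaBessel.exp_logE hν hQ hne
  have hnhds := isOpen_ball.mem_nhds hz
  have hlog := (hd.differentiableAt hnhds).hasDerivAt
  have heq : (fun z => Complex.exp (logE a b c ν z)) =ᶠ[𝓝 z] fun z => E a b c ν (z ^ 2) := by
    filter_upwards [hnhds] with w hw using hexp w hw
  have hlogE : z * deriv (logE a b c ν) z = 2 * (z ^ 2 * logDeriv (E a b c ν) (z ^ 2)) := by
    refine mul_right_cancel₀ (hne z hz) ?_
    rw [← mul_deriv_comp_sq (differentiable_of_hasPowerSeriesOnDisk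
      (hasPowerSeriesOnDisk_E hν hQ)) (hne z hz), ← heq.deriv_eq, hlog.cexp.deriv,
      hexp z hz]
    ring
  rw [(hlog.div_const _).cexp.deriv]
  linear_combination (Complex.exp (logE a b c ν z / ν) / ν) * hlogE

theorem E_sq_ne_zero {lam : ℝ} (hE : IsFirstZero (E a b c ν) (lam ^ 2)) {z : ℂ}
    (hz : z ∈ ball (0 : ℂ) lam) : E a b c ν (z ^ 2) ≠ 0 := by
  refine hE.apply_ne_zero _ ?_
  rw [mem_ball_zero_iff] at hz ⊢
  rw [norm_pow]
  gcongr

variable {φ : ℂ → ℂ} {β lam : ℝ}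

theorem convexRadiusIsLeastRoot_fFun (hν : 0 < ν) (hQ : Q a b c ν ≠ 0)
    (hF : HasGeometricLogDeriv (ESeries a b c ν)) (hlam : 0 < lam)
    (hE : IsFirstZero (E a b c ν) (lam ^ 2)) (hβ : 0 < β)
    (hball : ball (1 : ℂ) β ⊆ φ '' ball 0 1) (hbdry : 1 - (β : ℂ) ∉ φ '' ball 0 1) :
    ConvexRadiusIsLeastRoot φ (fFun a b c ν) β lam :=
  have hne := fun z (hz : z ∈ ball (0 : ℂ) lam) => E_sq_ne_zero hE hz
  convexRadiusIsLeastRoot_of_isFirstZero (A := 2 / ν)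
    (q := fun z => Complex.exp (logE a b c ν z / ν)) two_ne_zero (by positivity) hlam hE
    (hasPowerSeriesOnDisk_E hν.le hQ) hF (fun _ => rfl)
    (((MaMindaBessel.exp_logE hν.le hQ hne).1.div_const _).cexp) (fun _ _ => Complex.exp_ne_zero _)
    (fun z hz => by simpa using mul_deriv_exp_logE_div hν.le hQ hne hz) hβ hball hbdry

theorem convexRadiusIsLeastRoot_gFun (hν : 0 ≤ ν) (hQ : Q a b c ν ≠ 0)
    (hF : HasGeometricLogDeriv (ESeries a b c ν)) (hlam : 0 < lam)
    (hE : IsFirstZero (E a b c ν) (lam ^ 2)) (hβ : 0 < β)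
    (hball : ball (1 : ℂ) β ⊆ φ '' ball 0 1) (hbdry : 1 - (β : ℂ) ∉ φ '' ball 0 1) :
    ConvexRadiusIsLeastRoot φ (gFun a b c ν) β lam :=
  have hseries := hasPowerSeriesOnDisk_E hν hQ
  have hd := differentiable_of_hasPowerSeriesOnDisk hseries
  convexRadiusIsLeastRoot_of_isFirstZero (A := 2) (q := fun z => E a b c ν (z ^ 2)) two_ne_zero
    two_pos hlam hE hseries hF (fun _ => rfl)
    (hd.fun_comp (differentiable_pow 2)).differentiableOn (fun _ hz => E_sq_ne_zero hE hz)
    (fun z hz => by simpa using mul_deriv_comp_sq hd (E_sq_ne_zero hE hz)) hβ hball hbdry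

theorem convexRadiusIsLeastRoot_hFun {Λ : ℝ} (hν : 0 ≤ ν) (hQ : Q a b c ν ≠ 0)
    (hF : HasGeometricLogDeriv (ESeries a b c ν)) (hE : IsFirstZero (E a b c ν) Λ) (hβ : 0 < β)
    (hball : ball (1 : ℂ) β ⊆ φ '' ball 0 1) (hbdry : 1 - (β : ℂ) ∉ φ '' ball 0 1) :
    ConvexRadiusIsLeastRoot φ (hFun a b c ν) β Λ :=
  have hseries := hasPowerSeriesOnDisk_E hν hQ
  convexRadiusIsLeastRoot_of_isFirstZero (A := 1) (q := E a b c ν) one_ne_zero one_pos hE.pos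
    (by rwa [pow_one]) hseries hF (fun _ => rfl)
    (differentiable_of_hasPowerSeriesOnDisk hseries).differentiableOn hE.apply_ne_zero
    (fun z hz => by
      have hne := hE.apply_ne_zero z hz
      rw [pow_one, logDeriv_apply, Complex.ofReal_one]
      field_simp) hβ hball hbdry

theorem mul_sub_nonneg_or_discrim_nonneg (habc : (c = 0 ∧ a ≠ b) ∨ (0 < c ∧ a < b)) :
    0 ≤ a * (b - a) ∨ 0 ≤ discrim a (b - a) c := by
  rw [discrim]
  rcases habc with ⟨rfl, -⟩ | ⟨hc, hab⟩
  · right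
    simpa using sq_nonneg (b - a)
  · rcases le_or_gt 0 a with ha | ha
    · exact .inl (mul_nonneg ha (sub_nonneg.2 hab.le))
    · right
      nlinarith [sq_nonneg (b - a), mul_pos_of_neg_of_neg ha (neg_neg_of_pos hc)]

end NormalizedN

theorem theorem4_general (a b c ν : ℝ) (habc : 0 ≤ a * (b - a) ∨ 0 ≤ discrim a (b - a) c)
    (hν : 0 ≤ ν) (hν₀ : ∀ x : ℝ, MaMindaBessel.Q a b c x = 0 → x ≤ ν)
    (hQ : MaMindaBessel.Q a b c ν ≠ 0) (φ : ℂ → ℂ) (β : ℝ) (hβ : 0 < β)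
    (hball : ball (1 : ℂ) β ⊆ φ '' ball 0 1) (hbdry : 1 - (β : ℂ) ∉ φ '' ball 0 1) :
    ∃ lam : ℝ, IsLeast {x : ℝ | 0 < x ∧ MaMindaBessel.besselN a b c ν x = 0} lam ∧
      (ν ≠ 0 → ConvexRadiusIsLeastRoot φ (MaMindaBessel.fFun a b c ν) β lam) ∧
      ConvexRadiusIsLeastRoot φ (MaMindaBessel.gFun a b c ν) β lam ∧
      ConvexRadiusIsLeastRoot φ (MaMindaBessel.hFun a b c ν) β (lam ^ 2) := by
  have hF := hasGeometricLogDeriv_ESeries habc (neg_one_lt_zero.trans_le hν) hν₀ hQ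
  obtain ⟨lam, hlam, hE⟩ := exists_isFirstZero_E hF hν hQ
  exact ⟨lam, isLeast_zeros_besselN hν hQ hlam hE,
    fun hν_ne => convexRadiusIsLeastRoot_fFun (hν.lt_of_ne' hν_ne) hQ hF hlam hE hβ hball hbdry,
    convexRadiusIsLeastRoot_gFun hν hQ hF hlam hE hβ hball hbdry,
    convexRadiusIsLeastRoot_hFun hν hQ hF hE hβ hball hbdry⟩

theorem theorem4 (a b c ν : ℝ)
    -- standing assumption on the coefficients
    (habc : (c = 0 ∧ a ≠ b) ∨ (0 < c ∧ a < b))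
    -- `ν ≥ max {0, ν₀}`, with `ν₀` the largest real root of `Q` (if there is one)
    (hν : 0 ≤ ν) (hν₀ : ∀ x : ℝ, MaMindaBessel.Q a b c x = 0 → x ≤ ν)
    -- the normalizing factor `2^ν Γ(ν+1) / Q(ν)` is defined
    (hQ : MaMindaBessel.Q a b c ν ≠ 0)
    (φ : ℂ → ℂ) (hφ : MaMindaBessel.IsMaMinda φ) (β : ℝ)
    -- `φ(-1) = 1 - β`, as a radial boundary value
    (hφ1 : Filter.Tendsto (fun x : ℝ => φ (x : ℂ)) (nhdsWithin (-1) (Set.Ioi (-1)))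
      (nhds (1 - (β : ℂ))))
    -- `{w : |w - 1| < β}` is the largest such disk in `φ(𝔻)`
    (hβ : IsGreatest {ρ : ℝ | Metric.ball (1 : ℂ) ρ ⊆ φ '' Metric.ball 0 1} β) :
    ∃ lam : ℝ, IsLeast {x : ℝ | 0 < x ∧ MaMindaBessel.besselN a b c ν (x : ℂ) = 0} lam ∧
      (ν ≠ 0 → ∃ R : ℝ,
        IsLeast {r : ℝ | 0 < r ∧
          (r : ℂ) * deriv (deriv (MaMindaBessel.fFun a b c ν)) (r : ℂ) +
            (β : ℂ) * deriv (MaMindaBessel.fFun a b c ν) (r : ℂ) = 0} R ∧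
        R < lam ∧
        MaMindaBessel.IsConvexRadius φ (MaMindaBessel.fFun a b c ν) R) ∧
      (∃ R : ℝ,
        IsLeast {r : ℝ | 0 < r ∧
          (r : ℂ) * deriv (deriv (MaMindaBessel.gFun a b c ν)) (r : ℂ) +
            (β : ℂ) * deriv (MaMindaBessel.gFun a b c ν) (r : ℂ) = 0} R ∧
        R < lam ∧
        MaMindaBessel.IsConvexRadius φ (MaMindaBessel.gFun a b c ν) R) ∧
      (∃ R : ℝ,
        IsLeast {r : ℝ | 0 < r ∧
          (r : ℂ) * deriv (deriv (MaMindaBessel.hFun a b c ν)) (r : ℂ) +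
            (β : ℂ) * deriv (MaMindaBessel.hFun a b c ν) (r : ℂ) = 0} R ∧
        R < lam ^ 2 ∧
        MaMindaBessel.IsConvexRadius φ (MaMindaBessel.hFun a b c ν) R) := by
  have hβ_pos : 0 < β := pos_of_isGreatest_ball_subset_image hφ.differentiableOn hφ.injOn
    isOpen_ball (mem_ball_self one_pos) hφ.map_zero hβ
  exact theorem4_general a b c ν (mul_sub_nonneg_or_discrim_nonneg habc) hν hν₀ hQ φ β hβ_pos hβ.1
    (notMem_image_of_tendsto_neg_one hφ.differentiableOn hφ.injOn hφ1)
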